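/- **Setting.** Consider the input-affine system $$\dot x=f(x,\theta)+g(x,\theta)u_p,\qquad y_p=h(x,\theta)+j(x,\theta)u_p,\qquad u_p=\mathrm{col}(u,E(t)),$$ with measured state $x(t)\in\mathbb R^n$, control $u(t)\in\mathbb R^m$, external sources $E(t)\in\mathbb R^{k}$ continuous and bounded on $[0,\infty)$, $y_p(t)\in\mathbb R^{m+k}$, constant unknown parameter $\theta\in\mathbb R^q$, and smooth $f,g,h,j$. Assume: * (dissipativity) there are a supply rate $s(u_p,y_p,\cdot)$, a storage function $S(x,\cdot)$ and an internal dissipation function $d(x,\cdot)$, with $S(\cdot,\theta)\ge0$ and $d(\cdot,\theta)\ge 0$, such that $\dot S=-d(x,\theta)+s(u_p,y_p,\theta)$ along the system, for all values of the state and of $u_p$; * (separable parameterization) $s=\phi_s^\top(u_p,y_p)\mathcal G_s(\theta)+b_s(u_p,y_p)$, $S=\phi_S^\top(x)\mathcal G_S(\theta)+b_S(x)$, $d=\phi_d^\top(x)\mathcal G_d(\theta)+b_d(x)$ with known smooth functions; $\mathcal G=\mathrm{col}(\mathcal G_s,\mathcal G_S,\mathcal G_d):\mathbb R^q\to\mathbb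 R^p$, $p\ge q$; * (monotonicity) there are a matrix $T\in\mathbb R^{q\times p}$, a positive definite $P\in\mathbb R^{q\times q}$ and $\rho>0$ with $(a-b)^\top P\,[T\mathcal G(a)-T\mathcal G(b)]\ge\rho|a-b|^2$ for all $a,b\in\mathbb R^q$; * (stabilizability) $x_\star(t)$ is a bounded reference with bounded derivative, and $\beta:\mathbb R^n\times\mathbb R^q\times[0,\infty)\to\mathbb R^m$ is smooth and, on bounded sets of $(x,\vartheta)$, bounded and Lipschitz in $(x,\vartheta)$ uniformly in $t\ge0$, such that the origin of the error dynamics $\dot{\tilde x}=f_\star(\tilde x,\theta,E,t)$ of $\tilde x=x-x_\star$ under $u=\beta(x,\theta,t)$ is uniformly asymptotically stable (UAS). For $\lambda>0$ let $F[v](t)=\int_0^t\lambda e^{-\lambda(t-\tau)}v(\tau)\,d\tau$ and $$Y=F[b_s-b_d]-F[\dot b_S],\qquad \Omega=\mathrm{col}\big(-F[\phi_s],\,F[\dot\phi_S],\,F[\phi_d]\big),$$ the functions being evaluated along the trajectory (dots are time derivatives). Apply $u=\beta(x,\hat\theta,t)$ with $\hat\theta$ generated by the G+D estimator with gains $\gamma_g,\gamma>0$: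 $$\dot{\hat\theta}_g=\gamma_g\Omega(Y-\Omega^\top\hat\theta_g),\quad \dot\Phi=-\gamma_g\Omega\Omega^\top\Phi,\ \Phi(0)=I_p,\quad \dot{\hat\theta}=\gamma PT\Delta[\mathcal Y-\Delta\mathcal G(\hat\theta)],$$ $$\Delta=\det(I_p-\Phi),\qquad \mathcal Y=\mathrm{adj}(I_p-\Phi)\,[\hat\theta_g-\Phi\hat\theta_g(0)],$$ with arbitrary $\hat\theta_g(0)$ and $\hat\theta(0)$. Write $\tilde\theta=\hat\theta-\theta$. Fix $M\in\mathbb R$ and $C_c,t_c>0$, and consider the closed-loop trajectories on $[0,\infty)$ whose regressor is bounded by $M$ and interval exciting: $\int_0^{t_c}\Omega\Omega^\top ds\ge C_cI_p$. **Claim.** (i) For every such trajectory, with $\Delta(t)$ and $\mathcal Y(t)$ the signals it generates, the zero equilibrium of the adaptive error system $$\dot{\tilde x}=f_\star(\tilde x,\theta,E,t)+g(\tilde x+x_\star,\theta)\begin{bmatrix}\beta(\tilde x+x_\star,\tilde\theta+\theta,t)-\beta(\tilde x+x_\star,\theta,t)\\0\end{bmatrix},\quad \dot{\tilde\theta}=\gamma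 PT\Delta(t)\big[\mathcal Y(t)-\Delta(t)\mathcal G(\tilde\theta+\theta)\big]$$ is UAS, with stability and attraction moduli common to all such trajectories (for the fixed $M,C_c,t_c$). (ii) Consequently there is $r>0$ such that along every such trajectory with $|\tilde x(0)|<r$ and $|\tilde\theta(0)|<r$, $\lim_{t\to\infty}\tilde x(t)=0$ and all signals $(x,\tilde x,u_p,y_p,\hat\theta,\tilde\theta,\hat\theta_g,\Phi,\Delta,\mathcal Y,\Omega,Y)$ are bounded. -/

import Mathlib

open Set Filter Topology
open scoped Matrix ContDiff

noncomputable section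

namespace PowerBalanceControl

/-- Column vectors of length `n`.  The norm used on them in boundedness and stability statements is
the sup norm; these notions do not depend on the choice of a norm in finite dimension.  Euclidean
quantities are written through the dot product. -/
abbrev Vec (n : ℕ) : Type := Fin n → ℝ

/-- Index set of the port variables `u_p = col(u, E)`: `m` controls and `k` external sources. -/
abbrev Port (m k : ℕ) : Type := Fin m ⊕ Fin k

/-- Port vectors. -/
abbrev PVec (m k : ℕ) : Type := Port m k → ℝ

/-- Index set of the regressor, of cardinality `p = ps + pS + pd`. -/
abbrev Reg (ps pS pd : ℕ) : Type := Fin ps ⊕ (Fin pS ⊕ Fin pd)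

/-! ### Stability of time-varying differential equations -/

section Stability

variable {V : Type*} [NormedAddCommGroup V] [NormedSpace ℝ V]

/-- `z` solves `ż = F(t, z)` on `[t₀, t₁]`. -/
def IsSolution (F : ℝ → V → V) (t₀ t₁ : ℝ) (z : ℝ → V) : Prop :=
  ∀ t ∈ Icc t₀ t₁, HasDerivWithinAt z (F t (z t)) (Icc t₀ t₁) t

/-- The origin is an equilibrium of every equation `ż = F(t, z)`, `F ∈ 𝓕`, and it is uniformly
asymptotically stable (uniformly with respect to the initial time `t₀ ≥ 0`), with stability and
attraction moduli that are common to all members of `𝓕`. -/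
def EquiUAS (𝓕 : Set (ℝ → V → V)) : Prop :=
  (∀ F ∈ 𝓕, ∀ t : ℝ, 0 ≤ t → F t 0 = 0) ∧
  (∀ ε : ℝ, 0 < ε → ∃ δ : ℝ, 0 < δ ∧
    ∀ F ∈ 𝓕, ∀ t₀ t₁ : ℝ, 0 ≤ t₀ → t₀ ≤ t₁ → ∀ z : ℝ → V,
      IsSolution F t₀ t₁ z → ‖z t₀‖ < δ → ‖z t₁‖ < ε) ∧
  (∃ r : ℝ, 0 < r ∧ ∀ ε : ℝ, 0 < ε → ∃ τ : ℝ, 0 < τ ∧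
    ∀ F ∈ 𝓕, ∀ t₀ t₁ : ℝ, 0 ≤ t₀ → t₀ + τ ≤ t₁ → ∀ z : ℝ → V,
      IsSolution F t₀ t₁ z → ‖z t₀‖ < r → ‖z t₁‖ < ε)

/-- The origin is a uniformly asymptotically stable equilibrium of `ż = F(t, z)`. -/
def IsUAS (F : ℝ → V → V) : Prop := EquiUAS {F}

end Stability

/-! ### Plant, parameterization, controller -/

/-- The input-affine system `ẋ = f(x,θ) + g(x,θ) u_p`, `y_p = h(x,θ) + j(x,θ) u_p`. -/
structure Plant (n m k q : ℕ) where
  f : Vec n → Vec q → Vec n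
  g : Vec n → Vec q → Matrix (Fin n) (Port m k) ℝ
  h : Vec n → Vec q → PVec m k
  j : Vec n → Vec q → Matrix (Port m k) (Port m k) ℝ
  smooth_f : ContDiff ℝ ∞ (fun z : Vec n × Vec q => f z.1 z.2)
  smooth_g : ∀ a b, ContDiff ℝ ∞ (fun z : Vec n × Vec q => g z.1 z.2 a b)
  smooth_h : ContDiff ℝ ∞ (fun z : Vec n × Vec q => h z.1 z.2)
  smooth_j : ∀ a b, ContDiff ℝ ∞ (fun z : Vec n × Vec q => j z.1 z.2 a b)

/-- Known functions of a separable parameterization of a supply rate, a storage function and an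
internal dissipation function. -/
structure Parameterization (n m k q ps pS pd : ℕ) where
  φs : PVec m k → PVec m k → Vec ps
  φS : Vec n → Vec pS
  φd : Vec n → Vec pd
  bs : PVec m k → PVec m k → ℝ
  bS : Vec n → ℝ
  bd : Vec n → ℝ
  Gs : Vec q → Vec ps
  GS : Vec q → Vec pS
  Gd : Vec q → Vec pd
  smooth_φs : ContDiff ℝ ∞ (fun z : PVec m k × PVec m k => φs z.1 z.2)
  smooth_φS : ContDiff ℝ ∞ φS
  smooth_φd : ContDiff ℝ ∞ φd
  smooth_bs : ContDiff ℝ ∞ (fun z : PVec m k × PVec m k => bs z.1 z.2)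
  smooth_bS : ContDiff ℝ ∞ bS
  smooth_bd : ContDiff ℝ ∞ bd
  smooth_Gs : ContDiff ℝ ∞ Gs
  smooth_GS : ContDiff ℝ ∞ GS
  smooth_Gd : ContDiff ℝ ∞ Gd

variable {n m k q ps pS pd : ℕ}

/-- The stacked mapping `𝒢(ϑ) = col(𝒢_s(ϑ), 𝒢_S(ϑ), 𝒢_d(ϑ))`. -/
def Parameterization.G (Q : Parameterization n m k q ps pS pd) (ϑ : Vec q) :
    Reg ps pS pd → ℝ :=
  Sum.elim (Q.Gs ϑ) (Sum.elim (Q.GS ϑ) (Q.Gd ϑ))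

/-- Power balance `Ṡ = -d + s` along the system with parameter `θ`, with nonnegative storage
function `S` and nonnegative internal dissipation function `d`. -/
def Dissipative (pl : Plant n m k q) (θ : Vec q) (s : PVec m k → PVec m k → Vec q → ℝ)
    (S d : Vec n → Vec q → ℝ) : Prop :=
  (∀ x, 0 ≤ S x θ) ∧ (∀ x, 0 ≤ d x θ) ∧
  ∀ (x : Vec n) (up : PVec m k),
    fderiv ℝ (fun y => S y θ) x (pl.f x θ + pl.g x θ *ᵥ up) =
      - d x θ + s up (pl.h x θ + pl.j x θ *ᵥ up) θ

/-- The supply rate, storage and dissipation functions have the separable representation `Q`. -/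
def Represents (Q : Parameterization n m k q ps pS pd)
    (s : PVec m k → PVec m k → Vec q → ℝ) (S d : Vec n → Vec q → ℝ) : Prop :=
  (∀ up yp ϑ, s up yp ϑ = Q.φs up yp ⬝ᵥ Q.Gs ϑ + Q.bs up yp) ∧
  (∀ x ϑ, S x ϑ = Q.φS x ⬝ᵥ Q.GS ϑ + Q.bS x) ∧
  (∀ x ϑ, d x ϑ = Q.φd x ⬝ᵥ Q.Gd ϑ + Q.bd x)

/-- Strong `P`-monotonicity of a mapping `W`. -/
def StronglyMonotone (P : Matrix (Fin q) (Fin q) ℝ) (W : Vec q → Vec q) : Prop :=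
  ∃ ρ : ℝ, 0 < ρ ∧ ∀ a b : Vec q,
    ρ * ((a - b) ⬝ᵥ (a - b)) ≤ (a - b) ⬝ᵥ (P *ᵥ (W a - W b))

/-- The reference trajectory is differentiable on `[0, ∞)`, bounded, with bounded derivative. -/
def IsReference (xs : ℝ → Vec n) : Prop :=
  DifferentiableOn ℝ xs (Ici 0) ∧
  ∃ B : ℝ, ∀ t : ℝ, 0 ≤ t → ‖xs t‖ ≤ B ∧ ‖derivWithin xs (Ici 0) t‖ ≤ B

/-- Regularity of the control law: smooth on `ℝⁿ × ℝ^q × [0, ∞)`, and, on bounded sets of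
`(x, ϑ)`, bounded and Lipschitz in `(x, ϑ)` uniformly with respect to `t ≥ 0`. -/
def IsControlLaw (β : Vec n → Vec q → ℝ → Vec m) : Prop :=
  ContDiffOn ℝ ∞ (fun z : Vec n × Vec q × ℝ => β z.1 z.2.1 z.2.2) {z | 0 ≤ z.2.2} ∧
  ∀ R : ℝ, ∃ L : ℝ, ∀ (t : ℝ) (x x' : Vec n) (ϑ ϑ' : Vec q), 0 ≤ t →
    ‖x‖ ≤ R → ‖x'‖ ≤ R → ‖ϑ‖ ≤ R → ‖ϑ'‖ ≤ R →
    ‖β x ϑ t‖ ≤ L ∧ ‖β x ϑ t - β x' ϑ' t‖ ≤ L * (‖x - x'‖ + ‖ϑ - ϑ'‖)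

/-- External sources: continuous and bounded on `[0, ∞)`. -/
def IsSource (E : ℝ → Vec k) : Prop :=
  ContinuousOn E (Ici 0) ∧ ∃ B : ℝ, ∀ t : ℝ, 0 ≤ t → ‖E t‖ ≤ B

/-- Error dynamics `f_⋆(x̃, θ, E, t)` of the plant in closed loop with the known-parameter control
`u = β(x, θ, t)`, where `x̃ = x - x_⋆`. -/
def nominalField (pl : Plant n m k q) (θ : Vec q) (E : ℝ → Vec k)
    (β : Vec n → Vec q → ℝ → Vec m) (xs : ℝ → Vec n) (t : ℝ) (ξ : Vec n) : Vec n :=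
  pl.f (ξ + xs t) θ + pl.g (ξ + xs t) θ *ᵥ Sum.elim (β (ξ + xs t) θ t) (E t)
    - derivWithin xs (Ici 0) t

/-! ### Filtered signals -/

/-- `F(𝔭)[v]`, `F(𝔭) = lam / (𝔭 + lam)`, with zero initial condition. -/
def lowPass (lam : ℝ) (v : ℝ → ℝ) (t : ℝ) : ℝ :=
  ∫ τ in (0 : ℝ)..t, lam * Real.exp (-lam * (t - τ)) * v τ

/-- `𝔭 F(𝔭)[v]`, that is, `F(𝔭)` with zero initial condition applied to `𝔭[v] = v̇`. -/
def lowPassDeriv (lam : ℝ) (v : ℝ → ℝ) (t : ℝ) : ℝ :=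
  lowPass lam (derivWithin v (Ici 0)) t

/-- `Y = F(𝔭)[b_s - b_d] - 𝔭 F(𝔭)[b_S]` for plant signals `x`, `u_p`, `y_p`. -/
def outputSignal (Q : Parameterization n m k q ps pS pd) (lam : ℝ) (x : ℝ → Vec n)
    (up yp : ℝ → PVec m k) (t : ℝ) : ℝ :=
  lowPass lam (fun τ => Q.bs (up τ) (yp τ) - Q.bd (x τ)) t
    - lowPassDeriv lam (fun τ => Q.bS (x τ)) t

/-- `Ω = col(-F(𝔭)[φ_s], 𝔭 F(𝔭)[φ_S], F(𝔭)[φ_d])` for plant signals `x`, `u_p`, `y_p`. -/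
def regressor (Q : Parameterization n m k q ps pS pd) (lam : ℝ) (x : ℝ → Vec n)
    (up yp : ℝ → PVec m k) (t : ℝ) : Reg ps pS pd → ℝ :=
  Sum.elim (fun i => - lowPass lam (fun τ => Q.φs (up τ) (yp τ) i) t)
    (Sum.elim (fun i => lowPassDeriv lam (fun τ => Q.φS (x τ) i) t)
      (fun i => lowPass lam (fun τ => Q.φd (x τ) i) t))

/-- Boundedness (by `M`) and interval excitation (with level `C` on `[0, tc]`) of a regressor. -/
def BoundedExciting {ι : Type} [Fintype ι] [DecidableEq ι] (M C tc : ℝ) (Ω : ℝ → ι → ℝ) : Prop :=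
  (∀ t : ℝ, 0 ≤ t → ‖Ω t‖ ≤ M) ∧
  Matrix.PosSemidef
    ((Matrix.of fun a b : ι => ∫ τ in (0 : ℝ)..tc, Ω τ a * Ω τ b) - C • (1 : Matrix ι ι ℝ))

/-! ### The adaptive closed loop -/

/-- Fixed data of the adaptive closed loop: the plant and its true parameter, the external sources,
the parameterization, the control law, the reference, and the design quantities `T`, `P`, the filter
constant `lam` and the estimator gains `γg`, `γ`. -/
structure Setup (n m k q ps pS pd : ℕ) where
  pl : Plant n m k q
  θ : Vec q
  E : ℝ → Vec k
  Q : Parameterization n m k q ps pS pd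
  β : Vec n → Vec q → ℝ → Vec m
  xs : ℝ → Vec n
  T : Matrix (Fin q) (Reg ps pS pd) ℝ
  P : Matrix (Fin q) (Fin q) ℝ
  lam : ℝ
  γg : ℝ
  γ : ℝ

/-- Candidate time evolution of the plant state `x` and of the estimator states
`θ̂_g`, `Φ` and `θ̂`. -/
structure Evolution (n q ps pS pd : ℕ) where
  x : ℝ → Vec n
  θg : ℝ → Reg ps pS pd → ℝ
  Φ : ℝ → Matrix (Reg ps pS pd) (Reg ps pS pd) ℝ
  θh : ℝ → Vec q

namespace Setup

variable (A : Setup n m k q ps pS pd) (w : Evolution n q ps pS pd)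

/-- Certainty-equivalent control `u = β(x, θ̂, t)`. -/
def u (t : ℝ) : Vec m := A.β (w.x t) (w.θh t) t

/-- Port input `u_p = col(u, E)`. -/
def up (t : ℝ) : PVec m k := Sum.elim (A.u w t) (A.E t)

/-- Port output `y_p`. -/
def yp (t : ℝ) : PVec m k := A.pl.h (w.x t) A.θ + A.pl.j (w.x t) A.θ *ᵥ A.up w t

/-- The signal `Y` along the evolution. -/
def Y (t : ℝ) : ℝ := outputSignal A.Q A.lam w.x (A.up w) (A.yp w) t

/-- The regressor `Ω` along the evolution. -/
def Ω (t : ℝ) : Reg ps pS pd → ℝ := regressor A.Q A.lam w.x (A.up w) (A.yp w) t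

/-- `Δ = det(I - Φ)`. -/
def Δ (w : Evolution n q ps pS pd) (t : ℝ) : ℝ := (1 - w.Φ t).det

/-- `𝒴 = adj(I - Φ) [θ̂_g - Φ θ̂_g(0)]`. -/
def calY (w : Evolution n q ps pS pd) (t : ℝ) : Reg ps pS pd → ℝ :=
  (1 - w.Φ t).adjugate *ᵥ (w.θg t - w.Φ t *ᵥ w.θg 0)

/-- Right-hand side of the estimator equation for `θ̂` along the evolution `w`, evaluated at an
arbitrary value `ϑ` of the estimate: `γ P T Δ [𝒴 - Δ 𝒢(ϑ)]`. -/
def estimatorField (t : ℝ) (ϑ : Vec q) : Vec q :=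
  A.γ • ((A.P * A.T) *ᵥ (Δ w t • (calY w t - Δ w t • A.Q.G ϑ)))

/-- `w` is a trajectory on `[0, ∞)` of the plant in closed loop with the certainty-equivalent control
and the interlaced gradient and mixing-based estimator; the initial values `x(0)`, `θ̂_g(0)` and
`θ̂(0)` are arbitrary and `Φ(0) = I`. -/
def IsTrajectory : Prop :=
  w.Φ 0 = 1 ∧
  ∀ t : ℝ, 0 ≤ t →
    HasDerivWithinAt w.x (A.pl.f (w.x t) A.θ + A.pl.g (w.x t) A.θ *ᵥ A.up w t) (Ici 0) t ∧
    HasDerivWithinAt w.θg ((A.γg * (A.Y w t - A.Ω w t ⬝ᵥ w.θg t)) • A.Ω w t) (Ici 0) t ∧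
    (∀ a b, HasDerivWithinAt (fun τ => w.Φ τ a b)
      ((-A.γg • (Matrix.vecMulVec (A.Ω w t) (A.Ω w t) * w.Φ t)) a b) (Ici 0) t) ∧
    HasDerivWithinAt w.θh (A.estimatorField w t (w.θh t)) (Ici 0) t

/-- State tracking error `x̃ = x - x_⋆`. -/
def xErr (t : ℝ) : Vec n := w.x t - A.xs t

/-- Parameter error `θ̃ = θ̂ - θ`. -/
def θErr (t : ℝ) : Vec q := w.θh t - A.θ

/-- Perturbation of the error dynamics caused by a parameter error `η`. -/
def perturbation (t : ℝ) (ξ : Vec n) (η : Vec q) : Vec n :=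
  A.pl.g (ξ + A.xs t) A.θ *ᵥ
    Sum.elim (A.β (ξ + A.xs t) (η + A.θ) t - A.β (ξ + A.xs t) A.θ t) (0 : Vec k)

/-- The adaptive error system in the variables `(x̃, θ̃)`: tracking error dynamics under the control
`β(x, θ̂, t)`, together with the dynamics of the parameter error for the estimator driven by the
signals generated along the trajectory `w`. -/
def errorField (t : ℝ) (z : Vec n × Vec q) : Vec n × Vec q :=
  (nominalField A.pl A.θ A.E A.β A.xs t z.1 + A.perturbation t z.1 z.2,
    A.estimatorField w t (z.2 + A.θ))

/-- All signals of the adaptive closed loop are bounded on `[0, ∞)`. -/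
def AllSignalsBounded : Prop :=
  ∃ B : ℝ, ∀ t : ℝ, 0 ≤ t →
    ‖w.x t‖ ≤ B ∧ ‖A.xErr w t‖ ≤ B ∧ ‖A.up w t‖ ≤ B ∧ ‖A.yp w t‖ ≤ B ∧
    ‖w.θh t‖ ≤ B ∧ ‖A.θErr w t‖ ≤ B ∧ ‖w.θg t‖ ≤ B ∧ (∀ a b, |w.Φ t a b| ≤ B) ∧
    |Δ w t| ≤ B ∧ ‖calY w t‖ ≤ B ∧ ‖A.Ω w t‖ ≤ B ∧ |A.Y w t| ≤ B

end Setup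

end PowerBalanceControl

end

namespace PowerBalanceControl

/-! ### Total stability of a uniformly asymptotically stable equilibrium -/

/-! The error system is a cascade: a parameter-error equation that does not see the tracking error
drives a perturbation of the nominal error dynamics.

Parameter error. Filtering the power balance gives the exact regression `Y = Ωᵀ 𝒢(θ)`
(`regression`). Hence `θ̂_g - 𝒢(θ)` and every `Φ v` solve the same gradient flow, and mixing with
the adjugate gives `𝒴 = Δ 𝒢(θ)` (`calY_eq`). Strong monotonicity makes `|θ̃|²` nonincreasing, with
rate proportional to `Δ²`. Interval excitation contracts the gradient flow by a factor depending
only on the gain, `M`, `C`, `tc` and the dimension (`exists_contraction_of_boundedExciting`);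
compactness of the set of such contractions turns this into a common bound `|Δ| ≥ D > 0` after `tc`
(`exists_abs_det_one_sub_ge`). So `θ̃` decays exponentially, uniformly over trajectories and initial
times (`exists_paramError_decay`).

Tracking error. Near the origin `θ̃` perturbs the nominal dynamics by at most `K ‖θ̃‖`. A UAS
equilibrium of a uniformly Lipschitz equation tolerates small persistent perturbations. This is
proved without a Lyapunov function, by comparing with exact solutions through Grönwall on windows of
fixed length (`totally_stable`, `totally_attractive`). The cascade is assembled in
`equiUAS_errorField`. Convergence and boundedness follow because the errors of a trajectory solve
the error system which that trajectory generates. -/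

theorem lt_of_forall_le_imp_lt {φ : ℝ → ℝ} {a b c : ℝ} (hφ : ContinuousOn φ (Icc a b))
    (ha : φ a < c) (h : ∀ t ∈ Icc a b, (∀ s ∈ Icc a t, φ s ≤ c) → φ t < c) :
    ∀ t ∈ Icc a b, φ t < c := by
  by_contra! hcon
  obtain ⟨t, ht, hct⟩ := hcon
  have hcl : IsCompact (Icc a b ∩ φ ⁻¹' Ici c) :=
    isCompact_Icc.of_isClosed_subset (hφ.preimage_isClosed_of_isClosed isClosed_Icc isClosed_Ici)
      inter_subset_left
  -- `T` is the first time at which the level `c` is reached; up to `T` the weak bound holds, so the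
  -- hypothesis gives the strict one at `T`, a contradiction.
  obtain ⟨T, ⟨hT, hcT⟩, hmin⟩ := hcl.exists_isLeast ⟨t, ht, hct⟩
  refine absurd (h T hT fun s hs => ?_) (not_lt.2 hcT)
  by_contra! hlt
  have hs' : s ∈ Icc a b := ⟨hs.1, hs.2.trans hT.2⟩
  have hsT : s = T := le_antisymm hs.2 (hmin ⟨hs', hlt.le⟩)
  subst hsT
  obtain ⟨s', hs'1, hs'2⟩ := intermediate_value_Icc hT.1
    (hφ.mono (Icc_subset_Icc_right hT.2)) ⟨ha.le, hlt.le⟩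
  have := hmin ⟨⟨hs'1.1, hs'1.2.trans hT.2⟩, hs'2.ge⟩
  have : s' = s := le_antisymm hs'1.2 this
  subst this
  exact hlt.ne' hs'2

/-- With zero initial gap the Grönwall bound is continuous in the defect and vanishes at defect
zero. -/
theorem exists_pos_gronwallBound_lt (K T : ℝ) {c : ℝ} (hc : 0 < c) :
    ∃ μ : ℝ, 0 < μ ∧ gronwallBound 0 K μ T < c := by
  have h : ∀ᶠ μ in 𝓝 (0 : ℝ), gronwallBound 0 K μ T < c :=
    (gronwallBound_continuous_ε 0 K T).continuousAt.eventually_lt continuousAt_const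
      (by simpa [gronwallBound_ε0_δ0] using hc)
  obtain ⟨μ, h1, h2⟩ := (h.filter_mono nhdsWithin_le_nhds |>.and
    (self_mem_nhdsWithin (a := (0 : ℝ)) (s := Ioi 0))).exists
  exact ⟨μ, h2, h1⟩

section Stability

variable {V : Type*} [NormedAddCommGroup V] [NormedSpace ℝ V]

theorem IsSolution.mono {F : ℝ → V → V} {t₀ t₁ s₀ s₁ : ℝ} {z : ℝ → V}
    (h : IsSolution F t₀ t₁ z) (h₀ : t₀ ≤ s₀) (h₁ : s₁ ≤ t₁) : IsSolution F s₀ s₁ z :=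
  fun t ht => (h t ⟨h₀.trans ht.1, ht.2.trans h₁⟩).mono (Icc_subset_Icc h₀ h₁)

/-- `z` solves `ż = N(t, z)` on `[t₀, t₁]` up to an error of size `μ`, as long as it stays in the
closed unit ball. -/
def IsApproxSolution (N : ℝ → V → V) (μ t₀ t₁ : ℝ) (z : ℝ → V) : Prop :=
  ∀ t ∈ Icc t₀ t₁, ∃ ζ : V, HasDerivWithinAt z ζ (Icc t₀ t₁) t ∧
    (‖z t‖ ≤ 1 → ‖ζ - N t (z t)‖ ≤ μ)

theorem IsApproxSolution.mono {N : ℝ → V → V} {μ ν t₀ t₁ s₀ s₁ : ℝ} {z : ℝ → V}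
    (h : IsApproxSolution N μ t₀ t₁ z) (hμ : μ ≤ ν) (h₀ : t₀ ≤ s₀) (h₁ : s₁ ≤ t₁) :
    IsApproxSolution N ν s₀ s₁ z := fun t ht => by
  obtain ⟨ζ, hζ, hb⟩ := h t ⟨h₀.trans ht.1, ht.2.trans h₁⟩
  exact ⟨ζ, hζ.mono (Icc_subset_Icc h₀ h₁), fun hz => (hb hz).trans hμ⟩

theorem IsApproxSolution.continuousOn {N : ℝ → V → V} {μ t₀ t₁ : ℝ} {z : ℝ → V}
    (h : IsApproxSolution N μ t₀ t₁ z) : ContinuousOn z (Icc t₀ t₁) := fun t ht => by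
  obtain ⟨ζ, hζ, -⟩ := h t ht
  exact hζ.continuousWithinAt

theorem IsSolution.continuousOn {F : ℝ → V → V} {t₀ t₁ : ℝ} {z : ℝ → V}
    (h : IsSolution F t₀ t₁ z) : ContinuousOn z (Icc t₀ t₁) :=
  fun t ht => (h t ht).continuousWithinAt

theorem hasDerivWithinAt_Ici_of_Icc {z : ℝ → V} {ζ : V} {a b t : ℝ} (ht : t ∈ Ico a b)
    (h : HasDerivWithinAt z ζ (Icc a b) t) : HasDerivWithinAt z ζ (Ici t) t :=
  (h.mono (Icc_subset_Icc_left ht.1)).mono_of_mem_nhdsWithin (Icc_mem_nhdsGE ht.2)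

theorem IsApproxSolution.dist_le {N : ℝ → V → V} {K : NNReal}
    (hN : ∀ t : ℝ, 0 ≤ t → LipschitzOnWith K (N t) (Metric.closedBall 0 1))
    {t₀ t₁ μ : ℝ} {z y : ℝ → V} (h₀ : 0 ≤ t₀)
    (hz : IsApproxSolution N μ t₀ t₁ z) (hy : IsSolution N t₀ t₁ y) (hzy : z t₀ = y t₀)
    (hz1 : ∀ t ∈ Icc t₀ t₁, ‖z t‖ ≤ 1) (hy1 : ∀ t ∈ Icc t₀ t₁, ‖y t‖ ≤ 1) :
    ∀ t ∈ Icc t₀ t₁, ‖z t - y t‖ ≤ gronwallBound 0 K μ (t - t₀) := by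
  intro t ht
  have hz' : ∀ t, ∃ ζ : V, t ∈ Icc t₀ t₁ → HasDerivWithinAt z ζ (Icc t₀ t₁) t ∧
      (‖z t‖ ≤ 1 → ‖ζ - N t (z t)‖ ≤ μ) := fun t => by
    by_cases ht : t ∈ Icc t₀ t₁
    · obtain ⟨ζ, hζ⟩ := hz t ht
      exact ⟨ζ, fun _ => hζ⟩
    · exact ⟨0, fun h => absurd h ht⟩
  choose ζ hζ using hz'
  have := dist_le_of_approx_trajectories_ODE_of_mem (v := N) (s := fun _ => Metric.closedBall 0 1)
    (K := K) (f := z) (g := y) (f' := ζ) (g' := fun t => N t (y t)) (a := t₀) (b := t₁)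
    (εf := μ) (εg := 0) (δ := 0) (fun t ht => hN t (h₀.trans ht.1)) hz.continuousOn
    (fun t ht => hasDerivWithinAt_Ici_of_Icc ht (hζ t (Ico_subset_Icc_self ht)).1)
    (fun t ht => by
      rw [dist_eq_norm]
      exact (hζ t (Ico_subset_Icc_self ht)).2 (hz1 t (Ico_subset_Icc_self ht)))
    (fun t ht => by simpa using hz1 t (Ico_subset_Icc_self ht)) hy.continuousOn
    (fun t ht => hasDerivWithinAt_Ici_of_Icc ht (hy t (Ico_subset_Icc_self ht)))
    (fun t ht => by simp) (fun t ht => by simpa using hy1 t (Ico_subset_Icc_self ht))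
    (by simp [hzy]) t ht
  simpa [dist_eq_norm] using this

/-- Grönwall needs `z` in the unit ball, which is known only once `z` is close to `y`. The
continuation principle breaks the circle: while `‖z‖ ≤ c + e ≤ 1`, Grönwall applies and yields the
strict inequality. -/
theorem IsApproxSolution.shadow {N : ℝ → V → V} {K : NNReal}
    (hN : ∀ t : ℝ, 0 ≤ t → LipschitzOnWith K (N t) (Metric.closedBall 0 1))
    {t₀ t₁ T μ c e : ℝ} {z y : ℝ → V} (h₀ : 0 ≤ t₀) (hT : t₁ ≤ t₀ + T) (hμ : 0 ≤ μ)
    (he : 0 < e) (hgr : gronwallBound 0 K μ T < e) (hce : c + e ≤ 1)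
    (hz : IsApproxSolution N μ t₀ t₁ z) (hy : IsSolution N t₀ (t₀ + T) y) (hzy : z t₀ = y t₀)
    (hyc : ∀ t ∈ Icc t₀ (t₀ + T), ‖y t‖ < c) :
    ∀ t ∈ Icc t₀ t₁, ‖z t - y t‖ < e ∧ ‖z t‖ < c + e := by
  have hy' : IsSolution N t₀ t₁ y := hy.mono le_rfl hT
  have hyc' : ∀ t ∈ Icc t₀ t₁, ‖y t‖ < c := fun t ht => hyc t ⟨ht.1, ht.2.trans hT⟩
  have key : ∀ t ∈ Icc t₀ t₁, (∀ s ∈ Icc t₀ t, ‖z s‖ ≤ c + e) → ‖z t - y t‖ < e := by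
    intro t ht hs
    refine lt_of_le_of_lt (((hz.mono le_rfl le_rfl ht.2).dist_le hN h₀
      (hy'.mono le_rfl ht.2) hzy (fun s h => (hs s h).trans hce)
      (fun s h => ?_) t ⟨ht.1, le_rfl⟩).trans ?_) hgr
    · linarith [hyc' s ⟨h.1, h.2.trans ht.2⟩]
    · exact gronwallBound_mono le_rfl hμ K.2 (by linarith [ht.2])
  have key2 : ∀ t ∈ Icc t₀ t₁, ‖z t‖ < c + e := by
    by_cases h01 : t₀ ≤ t₁
    · refine lt_of_forall_le_imp_lt hz.continuousOn.norm ?_ fun t ht hs => ?_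
      · rw [hzy]
        linarith [hyc' t₀ ⟨le_rfl, h01⟩]
      · have h1 := key t ht hs
        have h2 := hyc' t ht
        have h3 := norm_add_le (z t - y t) (y t)
        rw [sub_add_cancel] at h3
        linarith
    · intro t ht
      exact absurd (ht.1.trans ht.2) h01
  exact fun t ht => ⟨key t ht fun s hs => (key2 s ⟨hs.1, hs.2.trans ht.2⟩).le, key2 t ht⟩

/-- Local solvability of `ż = N(t, z)` on every interval `[t₀, t₀ + T]`, from small initial
values. -/
def LocallySolvable (N : ℝ → V → V) : Prop :=
  ∃ δ : ℝ, 0 < δ ∧ ∀ t₀ T : ℝ, 0 ≤ t₀ → 0 ≤ T → ∀ z₀ : V, ‖z₀‖ < δ →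
    ∃ y : ℝ → V, IsSolution N t₀ (t₀ + T) y ∧ y t₀ = z₀

theorem IsUAS.stable {N : ℝ → V → V} (h : IsUAS N) {ε : ℝ} (hε : 0 < ε) :
    ∃ δ : ℝ, 0 < δ ∧ ∀ t₀ t₁ : ℝ, 0 ≤ t₀ → ∀ z : ℝ → V,
      IsSolution N t₀ t₁ z → ‖z t₀‖ < δ → ∀ t ∈ Icc t₀ t₁, ‖z t‖ < ε := by
  obtain ⟨δ, hδ, H⟩ := h.2.1 ε hε
  exact ⟨δ, hδ, fun t₀ t₁ h₀ z hz hz0 t ht =>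
    H N rfl t₀ t h₀ ht.1 z (hz.mono le_rfl ht.2) hz0⟩

/-- Over one window of length `T`, the exact solution from the `δ`-ball stays below `ε / 2` and ends
below `δ / 2`. A defect `μ` adding less than `min (ε / 2) (δ / 2)` over the window keeps `z` below
`ε` and returns it to the `δ`-ball. The argument restarts with the same `μ`, so errors do not
accumulate over windows. -/
theorem IsUAS.totally_stable {N : ℝ → V → V} {K : NNReal}
    (hN : ∀ t : ℝ, 0 ≤ t → LipschitzOnWith K (N t) (Metric.closedBall 0 1))
    (hex : LocallySolvable N) (h : IsUAS N) {ε : ℝ} (hε : 0 < ε) :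
    ∃ δ : ℝ, 0 < δ ∧ ∃ μ : ℝ, 0 < μ ∧ ∀ t₀ t₁ : ℝ, 0 ≤ t₀ → t₀ ≤ t₁ → ∀ z : ℝ → V,
      IsApproxSolution N μ t₀ t₁ z → ‖z t₀‖ < δ → ‖z t₁‖ < ε := by
  -- The Lipschitz bound and the defect bound are available only in the unit ball.
  wlog hε1 : ε ≤ 1 generalizing ε
  · obtain ⟨δ, hδ, μ, hμ, H⟩ := this one_pos le_rfl
    exact ⟨δ, hδ, μ, hμ, fun t₀ t₁ h₀ h₁ z hz hz0 =>
      (H t₀ t₁ h₀ h₁ z hz hz0).trans (not_le.1 hε1)⟩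
  obtain ⟨δs, hδs, hst⟩ := h.stable (half_pos hε)
  obtain ⟨r, hr, hua⟩ := h.2.2
  obtain ⟨δe, hδe, hex⟩ := hex
  obtain ⟨δ, hδ, h1, h2, h3⟩ : ∃ δ : ℝ, 0 < δ ∧ δ ≤ δs ∧ δ ≤ r ∧ δ ≤ δe :=
    ⟨min δs (min r δe), by positivity, by simp, by simp, by simp⟩
  obtain ⟨T, hT, hua⟩ := hua (δ / 2) (half_pos hδ)
  obtain ⟨μ, hμ, hgr⟩ := exists_pos_gronwallBound_lt K T (c := min (ε / 2) (δ / 2)) (by positivity)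
  refine ⟨δ, hδ, μ, hμ, ?_⟩
  have step : ∀ t₀ t₁ : ℝ, 0 ≤ t₀ → t₁ ≤ t₀ + T → ∀ z : ℝ → V,
      IsApproxSolution N μ t₀ t₁ z → ‖z t₀‖ < δ → ∀ t ∈ Icc t₀ t₁,
        ‖z t‖ < ε ∧ (t = t₀ + T → ‖z t‖ < δ) := by
    intro t₀ t₁ h₀ h₁ z hz hz0 t ht
    obtain ⟨y, hy, hy0⟩ := hex t₀ T h₀ hT.le (z t₀) (hz0.trans_le h3)
    have hyc := hst t₀ (t₀ + T) h₀ y hy (by rw [hy0]; exact hz0.trans_le h1)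
    obtain ⟨hd, hb⟩ := hz.shadow hN h₀ h₁ hμ.le (e := min (ε / 2) (δ / 2)) (by positivity) hgr
      (by linarith [min_le_left (ε / 2) (δ / 2)]) hy hy0.symm hyc t ht
    refine ⟨hb.trans_le (by linarith [min_le_left (ε / 2) (δ / 2)]), fun htT => ?_⟩
    have hyT := hua N rfl t₀ t h₀ htT.ge y (hy.mono le_rfl htT.le)
      (by rw [hy0]; exact hz0.trans_le h2)
    have h3 := norm_add_le (z t - y t) (y t)
    rw [sub_add_cancel] at h3
    linarith [min_le_right (ε / 2) (δ / 2)]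
  have iter : ∀ j : ℕ, ∀ t₀ t₁ : ℝ, 0 ≤ t₀ → t₀ ≤ t₁ → t₁ ≤ t₀ + (j + 1) * T → ∀ z : ℝ → V,
      IsApproxSolution N μ t₀ t₁ z → ‖z t₀‖ < δ → ‖z t₁‖ < ε := by
    intro j
    induction j with
    | zero =>
      intro t₀ t₁ h₀ h01 h₁ z hz hz0
      exact (step t₀ t₁ h₀ (by simpa using h₁) z hz hz0 t₁ ⟨h01, le_rfl⟩).1
    | succ j ih =>
      intro t₀ t₁ h₀ h01 h₁ z hz hz0
      by_cases hle : t₁ ≤ t₀ + T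
      · exact (step t₀ t₁ h₀ hle z hz hz0 t₁ ⟨h01, le_rfl⟩).1
      · push Not at hle
        have := (step t₀ (t₀ + T) h₀ le_rfl z (hz.mono le_rfl le_rfl hle.le) hz0 (t₀ + T)
          ⟨by linarith, le_rfl⟩).2 rfl
        refine ih (t₀ + T) t₁ (by linarith) hle.le ?_ z (hz.mono le_rfl (by linarith) le_rfl) this
        push_cast at h₁
        linarith
  intro t₀ t₁ h₀ h01 z hz hz0
  obtain ⟨j, hj⟩ := exists_nat_ge ((t₁ - t₀) / T)
  refine iter j t₀ t₁ h₀ h01 ?_ z hz hz0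
  rw [div_le_iff₀ hT] at hj
  linarith

/-- The radius is fixed before `ε`. One window of nominal attraction brings `z` into the ball from
which total stability keeps it below `ε`; only the window length and the admissible defect depend on
`ε`. -/
theorem IsUAS.totally_attractive {N : ℝ → V → V} {K : NNReal}
    (hN : ∀ t : ℝ, 0 ≤ t → LipschitzOnWith K (N t) (Metric.closedBall 0 1))
    (hex : LocallySolvable N) (h : IsUAS N) :
    ∃ r : ℝ, 0 < r ∧ ∀ ε : ℝ, 0 < ε → ∃ μ : ℝ, 0 < μ ∧ ∃ τ : ℝ, 0 < τ ∧
      ∀ t₀ t₁ : ℝ, 0 ≤ t₀ → t₀ + τ ≤ t₁ → ∀ z : ℝ → V,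
      IsApproxSolution N μ t₀ t₁ z → ‖z t₀‖ < r → ‖z t₁‖ < ε := by
  obtain ⟨δs, hδs, hst⟩ := h.stable (ε := 1 / 2) (by norm_num)
  obtain ⟨r, hr, hua⟩ := h.2.2
  obtain ⟨δe, hδe, hex'⟩ := id hex
  obtain ⟨r₀, hr₀, h1, h2, h3⟩ : ∃ δ : ℝ, 0 < δ ∧ δ ≤ δs ∧ δ ≤ r ∧ δ ≤ δe :=
    ⟨min δs (min r δe), by positivity, by simp, by simp, by simp⟩
  refine ⟨r₀, hr₀, fun ε hε => ?_⟩
  obtain ⟨δ, hδ, μ₁, hμ₁, H⟩ := h.totally_stable hN hex hε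
  obtain ⟨T, hT, hua⟩ := hua (δ / 2) (half_pos hδ)
  obtain ⟨μ₂, hμ₂, hgr⟩ := exists_pos_gronwallBound_lt K T (c := min (1 / 2) (δ / 2))
    (by positivity)
  refine ⟨min μ₁ μ₂, by positivity, T, hT, fun t₀ t₁ h₀ h₁ z hz hz0 => ?_⟩
  refine H (t₀ + T) t₁ (by linarith) h₁ z (hz.mono (min_le_left _ _) (by linarith) le_rfl) ?_
  obtain ⟨y, hy, hy0⟩ := hex' t₀ T h₀ hT.le (z t₀) (hz0.trans_le h3)
  have hyc := hst t₀ (t₀ + T) h₀ y hy (by rw [hy0]; exact hz0.trans_le h1)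
  obtain ⟨hd, -⟩ := (hz.mono (min_le_right _ _) le_rfl h₁).shadow hN h₀ le_rfl hμ₂.le
    (e := min (1 / 2) (δ / 2)) (by positivity) hgr
    (by linarith [min_le_left (1 / 2) (δ / 2)]) hy hy0.symm hyc (t₀ + T) ⟨by linarith, le_rfl⟩
  have hyT := hua N rfl t₀ (t₀ + T) h₀ le_rfl y hy (by rw [hy0]; exact hz0.trans_le h2)
  have h3 := norm_add_le (z (t₀ + T) - y (t₀ + T)) (y (t₀ + T))
  rw [sub_add_cancel] at h3
  linarith [min_le_right (1 / 2) (δ / 2)]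

end Stability

/-! ### The gradient flow driven by a regressor -/

section Gradient

variable {ι : Type} [Fintype ι]

theorem dotProduct_self_nonneg_real (v : ι → ℝ) : 0 ≤ v ⬝ᵥ v :=
  Finset.sum_nonneg fun i _ => mul_self_nonneg (v i)

theorem hasDerivWithinAt_dotProduct_self {e : ℝ → ι → ℝ} {e' : ι → ℝ} {s : Set ℝ} {t : ℝ}
    (h : HasDerivWithinAt e e' s t) :
    HasDerivWithinAt (fun τ => e τ ⬝ᵥ e τ) (2 * (e t ⬝ᵥ e')) s t := by
  rw [hasDerivWithinAt_pi] at h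
  have := HasDerivWithinAt.fun_sum (u := Finset.univ) fun i _ => (h i).mul (h i)
  refine this.congr_deriv ?_
  simp only [dotProduct, Finset.mul_sum]
  exact Finset.sum_congr rfl fun i _ => by ring

/-- `e` solves the gradient flow `ė = -g Ω Ωᵀ e` on `[0, ∞)`. -/
def IsGradientFlow (g : ℝ) (Ω e : ℝ → ι → ℝ) : Prop :=
  ∀ t : ℝ, 0 ≤ t → HasDerivWithinAt e ((-(g * (Ω t ⬝ᵥ e t))) • Ω t) (Ici 0) t

variable {g : ℝ} {Ω e e₁ e₂ : ℝ → ι → ℝ}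

theorem IsGradientFlow.sub (h₁ : IsGradientFlow g Ω e₁) (h₂ : IsGradientFlow g Ω e₂) :
    IsGradientFlow g Ω (fun t => e₁ t - e₂ t) := fun t ht => by
  refine ((h₁ t ht).sub (h₂ t ht)).congr_deriv ?_
  rw [dotProduct_sub, ← sub_smul]
  congr 1
  ring

theorem IsGradientFlow.continuousOn (h : IsGradientFlow g Ω e) : ContinuousOn e (Ici 0) :=
  fun t ht => (h t ht).continuousWithinAt

theorem IsGradientFlow.hasDerivWithinAt_energy (h : IsGradientFlow g Ω e) {t : ℝ} (ht : 0 ≤ t) :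
    HasDerivWithinAt (fun τ => e τ ⬝ᵥ e τ) (-(2 * g * (Ω t ⬝ᵥ e t) ^ 2)) (Ici 0) t := by
  refine (hasDerivWithinAt_dotProduct_self (h t ht)).congr_deriv ?_
  rw [dotProduct_smul, dotProduct_comm (e t), smul_eq_mul]
  ring

theorem IsGradientFlow.antitoneOn (h : IsGradientFlow g Ω e) (hg : 0 ≤ g) :
    AntitoneOn (fun t => e t ⬝ᵥ e t) (Ici 0) := by
  refine antitoneOn_of_hasDerivWithinAt_nonpos (convex_Ici 0)
    (f' := fun t => -(2 * g * (Ω t ⬝ᵥ e t) ^ 2))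
    (fun t ht => (h.hasDerivWithinAt_energy ht).continuousWithinAt) (fun t ht => ?_) fun t _ => ?_
  · exact (h.hasDerivWithinAt_energy (interior_subset ht)).mono interior_subset
  · have : 0 ≤ 2 * g * (Ω t ⬝ᵥ e t) ^ 2 := by positivity
    linarith

theorem IsGradientFlow.eq_zero (h : IsGradientFlow g Ω e) (hg : 0 ≤ g) (h0 : e 0 = 0) {t : ℝ}
    (ht : 0 ≤ t) : e t = 0 := by
  have := h.antitoneOn hg (mem_Ici.2 le_rfl) (mem_Ici.2 ht) ht
  simp only [h0, dotProduct_zero] at this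
  exact dotProduct_self_eq_zero.1 (le_antisymm this (dotProduct_self_nonneg_real _))

theorem abs_dotProduct_le {v w : ι → ℝ} {a b : ℝ} (hv : ∀ i, |v i| ≤ a) (hw : ∀ i, |w i| ≤ b)
    (ha : 0 ≤ a) : |v ⬝ᵥ w| ≤ Fintype.card ι * (a * b) := by
  refine (Finset.abs_sum_le_sum_abs _ _).trans ?_
  refine (Finset.sum_le_sum (g := fun _ => a * b) fun i _ => ?_).trans_eq (by simp)
  rw [abs_mul]
  exact mul_le_mul (hv i) (hw i) (abs_nonneg _) ha

/-- Cauchy–Schwarz, from integrating `(|f| - m / T)² ≥ 0` with `m / T` the mean of `|f|`. -/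
theorem sq_integral_abs_le {f : ℝ → ℝ} {T : ℝ} (hT : 0 < T) (hf : ContinuousOn f (Icc 0 T)) :
    (∫ t in (0 : ℝ)..T, |f t|) ^ 2 ≤ T * ∫ t in (0 : ℝ)..T, f t ^ 2 := by
  set m := ∫ t in (0 : ℝ)..T, |f t| with hm
  have h1 : IntervalIntegrable (fun t => |f t|) MeasureTheory.volume 0 T :=
    ContinuousOn.intervalIntegrable (by rw [uIcc_of_le hT.le]; exact hf.abs)
  have h2 : IntervalIntegrable (fun t => f t ^ 2) MeasureTheory.volume 0 T :=
    ContinuousOn.intervalIntegrable (by rw [uIcc_of_le hT.le]; exact hf.pow 2)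
  have h3 : 0 ≤ ∫ t in (0 : ℝ)..T, (f t ^ 2 - 2 * (m / T) * |f t| + (m / T) ^ 2) :=
    intervalIntegral.integral_nonneg hT.le fun t _ => by
      have := sq_nonneg (|f t| - m / T)
      rw [sub_sq, sq_abs] at this
      linarith
  rw [intervalIntegral.integral_add (h2.sub (h1.const_mul _)) (by simp),
    intervalIntegral.integral_sub h2 (h1.const_mul _), intervalIntegral.integral_const_mul,
    ← hm, intervalIntegral.integral_const, smul_eq_mul] at h3
  have h4 : T * ((∫ t in (0 : ℝ)..T, f t ^ 2) - 2 * (m / T) * m + (T - 0) * (m / T) ^ 2)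
      = T * (∫ t in (0 : ℝ)..T, f t ^ 2) - m ^ 2 := by
    field_simp
    ring
  have h5 := mul_nonneg hT.le h3
  rw [h4] at h5
  linarith

theorem continuousOn_dotProduct {α : Type*} [TopologicalSpace α] {s : Set α} {v w : α → ι → ℝ}
    (hv : ContinuousOn v s) (hw : ContinuousOn w s) : ContinuousOn (fun t => v t ⬝ᵥ w t) s :=
  continuousOn_finsetSum _ fun i _ =>
    (continuousOn_pi.1 hv i).mul (continuousOn_pi.1 hw i)

theorem IsGradientFlow.energy_eq (h : IsGradientFlow g Ω e) (hΩ : ContinuousOn Ω (Ici 0)) {T : ℝ}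
    (hT : 0 ≤ T) :
    2 * g * (∫ t in (0 : ℝ)..T, (Ω t ⬝ᵥ e t) ^ 2) = e 0 ⬝ᵥ e 0 - e T ⬝ᵥ e T := by
  have hc : ContinuousOn (fun t => -(2 * g * (Ω t ⬝ᵥ e t) ^ 2)) (Icc 0 T) :=
    ((continuousOn_const.mul ((continuousOn_dotProduct hΩ h.continuousOn).pow 2)).neg).mono
      Icc_subset_Ici_self
  have := intervalIntegral.integral_eq_sub_of_hasDeriv_right_of_le hT
    (f := fun t => e t ⬝ᵥ e t) (f' := fun t => -(2 * g * (Ω t ⬝ᵥ e t) ^ 2))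
    (fun t ht => ((h.hasDerivWithinAt_energy ht.1).continuousWithinAt.mono Icc_subset_Ici_self))
    (fun t ht => (h.hasDerivWithinAt_energy ht.1.le).mono
      (Ioi_subset_Ici_self.trans (Ici_subset_Ici.2 ht.1.le)))
    (ContinuousOn.intervalIntegrable (by rwa [uIcc_of_le hT]))
  rw [intervalIntegral.integral_neg, intervalIntegral.integral_const_mul] at this
  linarith

/-- The velocity is a multiple of `Ω ⬝ᵥ e`, the quantity whose square is dissipated. Little
dissipation therefore means little motion. -/
theorem IsGradientFlow.abs_sub_le (h : IsGradientFlow g Ω e) (hg : 0 ≤ g)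
    (hΩ : ContinuousOn Ω (Ici 0)) {M T t : ℝ} (hM : ∀ t, 0 ≤ t → ‖Ω t‖ ≤ M) (ht : t ∈ Icc 0 T)
    (i : ι) : |e t i - e 0 i| ≤ g * M * ∫ τ in (0 : ℝ)..T, |Ω τ ⬝ᵥ e τ| := by
  have hM0 : 0 ≤ M := (norm_nonneg _).trans (hM 0 le_rfl)
  have hd : ContinuousOn (fun τ => Ω τ ⬝ᵥ e τ) (Ici 0) := continuousOn_dotProduct hΩ h.continuousOn
  have hi : ∀ τ, 0 ≤ τ → HasDerivWithinAt (fun τ => e τ i) (-(g * (Ω τ ⬝ᵥ e τ)) * Ω τ i)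
      (Ici 0) τ := fun τ hτ => by
    simpa using hasDerivWithinAt_pi.1 (h τ hτ) i
  have hc : ContinuousOn (fun τ => -(g * (Ω τ ⬝ᵥ e τ)) * Ω τ i) (Ici 0) :=
    (continuousOn_const.mul hd).neg.mul (continuousOn_pi.1 hΩ i)
  have h1 := intervalIntegral.integral_eq_sub_of_hasDeriv_right_of_le ht.1
    (f := fun τ => e τ i) (f' := fun τ => -(g * (Ω τ ⬝ᵥ e τ)) * Ω τ i)
    (fun τ hτ => ((hi τ hτ.1).continuousWithinAt.mono Icc_subset_Ici_self))
    (fun τ hτ => (hi τ hτ.1.le).mono (Ioi_subset_Ici_self.trans (Ici_subset_Ici.2 hτ.1.le)))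
    (ContinuousOn.intervalIntegrable (by
      rw [uIcc_of_le ht.1]; exact hc.mono Icc_subset_Ici_self))
  rw [← h1]
  have hint : ∀ s, 0 ≤ s → IntervalIntegrable (fun τ => |Ω τ ⬝ᵥ e τ|) MeasureTheory.volume 0 s :=
    fun s hs => ContinuousOn.intervalIntegrable (by
      rw [uIcc_of_le hs]; exact hd.abs.mono Icc_subset_Ici_self)
  refine (intervalIntegral.abs_integral_le_integral_abs ht.1).trans ?_
  have h2 : ∫ τ in (0 : ℝ)..t, |-(g * (Ω τ ⬝ᵥ e τ)) * Ω τ i|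
      ≤ ∫ τ in (0 : ℝ)..t, g * M * |Ω τ ⬝ᵥ e τ| := by
    refine intervalIntegral.integral_mono_on ht.1 (ContinuousOn.intervalIntegrable (by
      rw [uIcc_of_le ht.1]; exact hc.abs.mono Icc_subset_Ici_self)) ((hint t ht.1).const_mul _)
      fun τ hτ => ?_
    rw [abs_mul, abs_neg, abs_mul, abs_of_nonneg hg]
    have h3 : |Ω τ i| ≤ M := (norm_le_pi_norm (Ω τ) i).trans (hM τ hτ.1)
    calc g * |Ω τ ⬝ᵥ e τ| * |Ω τ i| ≤ g * |Ω τ ⬝ᵥ e τ| * M := by gcongr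
      _ = g * M * |Ω τ ⬝ᵥ e τ| := by ring
  refine h2.trans ?_
  rw [intervalIntegral.integral_const_mul]
  refine mul_le_mul_of_nonneg_left ?_ (by positivity)
  exact intervalIntegral.integral_mono_interval le_rfl ht.1 ht.2
    (Eventually.of_forall fun _ => abs_nonneg _) (hint T (ht.1.trans ht.2))

variable [DecidableEq ι]

theorem BoundedExciting.le_integral {M C T : ℝ} (h : BoundedExciting M C T Ω)
    (hΩ : ContinuousOn Ω (Ici 0)) (hT : 0 ≤ T) (v : ι → ℝ) :
    C * (v ⬝ᵥ v) ≤ ∫ t in (0 : ℝ)..T, (Ω t ⬝ᵥ v) ^ 2 := by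
  have h1 := h.2.dotProduct_mulVec_nonneg v
  have hi : ∀ a b, IntervalIntegrable (fun τ => Ω τ a * Ω τ b) MeasureTheory.volume 0 T :=
    fun a b => ContinuousOn.intervalIntegrable (by
      rw [uIcc_of_le hT]
      exact ((continuousOn_pi.1 hΩ a).mul (continuousOn_pi.1 hΩ b)).mono Icc_subset_Ici_self)
  have h2 : ∫ t in (0 : ℝ)..T, (Ω t ⬝ᵥ v) ^ 2
      = v ⬝ᵥ ((Matrix.of fun a b : ι => ∫ τ in (0 : ℝ)..T, Ω τ a * Ω τ b) *ᵥ v) := by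
    have h3 : ∀ t, (Ω t ⬝ᵥ v) ^ 2 = ∑ a, ∑ b, (v a * v b) * (Ω t a * Ω t b) := fun t => by
      rw [sq, dotProduct, Finset.sum_mul_sum]
      exact Finset.sum_congr rfl fun a _ => Finset.sum_congr rfl fun b _ => by ring
    simp_rw [h3]
    have h4 : ∀ a, IntervalIntegrable (fun τ => ∑ b, (v a * v b) * (Ω τ a * Ω τ b))
        MeasureTheory.volume 0 T := fun a => by
      have := IntervalIntegrable.sum Finset.univ fun b _ => (hi a b).const_mul (v a * v b)
      exact this.congr fun τ _ => by simp
    rw [intervalIntegral.integral_finsetSum fun a _ => h4 a]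
    simp only [dotProduct, Matrix.mulVec, Finset.mul_sum, Matrix.of_apply]
    refine Finset.sum_congr rfl fun a _ => ?_
    rw [intervalIntegral.integral_finsetSum fun b _ => (hi a b).const_mul _]
    refine Finset.sum_congr rfl fun b _ => ?_
    rw [intervalIntegral.integral_const_mul]
    ring
  rw [Matrix.sub_mulVec, dotProduct_sub, Matrix.smul_mulVec, Matrix.one_mulVec, dotProduct_smul,
    star_trivial, ← h2, smul_eq_mul] at h1
  linarith

/-- Interval excitation makes the gradient flow contract over the interval of excitation, with a
rate that depends on the regressor only through its bound and its level of excitation. -/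
theorem exists_contraction_of_boundedExciting (ι : Type) [Fintype ι] [DecidableEq ι]
    {g M C T : ℝ} (hg : 0 < g) (hC : 0 < C) (hT : 0 < T) :
    ∃ c : ℝ, 0 < c ∧ ∀ Ω e : ℝ → ι → ℝ, ContinuousOn Ω (Ici 0) → BoundedExciting M C T Ω →
      IsGradientFlow g Ω e → ∀ t, T ≤ t → e t ⬝ᵥ e t ≤ (1 - c) * (e 0 ⬝ᵥ e 0) := by
  set N : ℝ := Fintype.card ι * (M * (g * M)) with hN
  set κ : ℝ := 2 + 2 * N ^ 2 * T ^ 2 with hκ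
  have hκ0 : 0 < κ := by positivity
  refine ⟨2 * g * C / κ, by positivity, fun Ω e hΩ hex he t ht => ?_⟩
  have hM0 : 0 ≤ M := (norm_nonneg _).trans (hex.1 0 le_rfl)
  refine (he.antitoneOn hg.le (mem_Ici.2 hT.le) (mem_Ici.2 (hT.le.trans ht)) ht).trans ?_
  change e T ⬝ᵥ e T ≤ _
  set D := ∫ t in (0 : ℝ)..T, (Ω t ⬝ᵥ e t) ^ 2 with hD
  set m := ∫ t in (0 : ℝ)..T, |Ω t ⬝ᵥ e t| with hm
  have hen := he.energy_eq hΩ hT.le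
  have hd : ContinuousOn (fun τ => Ω τ ⬝ᵥ e τ) (Icc 0 T) :=
    (continuousOn_dotProduct hΩ he.continuousOn).mono Icc_subset_Ici_self
  have hcs : m ^ 2 ≤ T * D := sq_integral_abs_le hT hd
  -- Excitation controls `Ω ⬝ᵥ e 0` with `e` frozen, while dissipation measures `Ω ⬝ᵥ e τ`; the
  -- difference is bounded by the drift of `e`, hence by `D` again. Integrating over `[0, T]`
  -- produces `κ`.
  have hpt : ∀ τ ∈ Icc 0 T, (Ω τ ⬝ᵥ e 0) ^ 2 ≤ 2 * (Ω τ ⬝ᵥ e τ) ^ 2 + 2 * N ^ 2 * (T * D) := by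
    intro τ hτ
    have h1 : |Ω τ ⬝ᵥ (e τ - e 0)| ≤ N * m := by
      refine (abs_dotProduct_le (a := M) (b := g * M * m)
        (fun i => (norm_le_pi_norm (Ω τ) i).trans (hex.1 τ hτ.1))
        (fun i => he.abs_sub_le hg.le hΩ hex.1 hτ i) hM0).trans_eq ?_
      rw [hN]
      ring
    have h2 : (Ω τ ⬝ᵥ (e τ - e 0)) ^ 2 ≤ N ^ 2 * (T * D) := by
      calc (Ω τ ⬝ᵥ (e τ - e 0)) ^ 2 ≤ (N * m) ^ 2 := sq_le_sq.2 (h1.trans (le_abs_self _))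
        _ = N ^ 2 * m ^ 2 := by ring
        _ ≤ N ^ 2 * (T * D) := by gcongr
    rw [dotProduct_sub] at h2
    nlinarith [sq_nonneg (2 * (Ω τ ⬝ᵥ e τ) - Ω τ ⬝ᵥ e 0)]
  have h3 : C * (e 0 ⬝ᵥ e 0) ≤ κ * D := by
    refine (hex.le_integral hΩ hT.le (e 0)).trans ?_
    have hi : IntervalIntegrable (fun τ => 2 * (Ω τ ⬝ᵥ e τ) ^ 2) MeasureTheory.volume 0 T :=
      ContinuousOn.intervalIntegrable (by
        rw [uIcc_of_le hT.le]; exact continuousOn_const.mul (hd.pow 2))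
    refine (intervalIntegral.integral_mono_on hT.le (ContinuousOn.intervalIntegrable (by
        rw [uIcc_of_le hT.le]
        exact ((continuousOn_dotProduct hΩ continuousOn_const).pow 2).mono Icc_subset_Ici_self))
      (hi.add (intervalIntegrable_const (c := 2 * N ^ 2 * (T * D)))) hpt).trans_eq ?_
    rw [intervalIntegral.integral_add hi (by simp), intervalIntegral.integral_const_mul, ← hD,
      intervalIntegral.integral_const, smul_eq_mul, hκ]
    ring
  have h4 : 2 * g * C / κ * (e 0 ⬝ᵥ e 0) ≤ 2 * g * D := by
    rw [div_mul_eq_mul_div, div_le_iff₀ hκ0]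
    nlinarith
  linarith

/-! ### Uniform invertibility of `1 - B` for contractions `B`, and the transition matrix -/

theorem abs_le_one_of_energy_le {B : Matrix ι ι ℝ}
    (h : ∀ v : ι → ℝ, (B *ᵥ v) ⬝ᵥ (B *ᵥ v) ≤ v ⬝ᵥ v) (a b : ι) : |B a b| ≤ 1 := by
  have h1 := h (Pi.single b 1)
  have h2 : (B *ᵥ Pi.single b 1) a = B a b := by simp
  have h3 : (B a b) ^ 2 ≤ (B *ᵥ Pi.single b 1) ⬝ᵥ (B *ᵥ Pi.single b 1) := by
    rw [← h2, sq]
    exact Finset.single_le_sum (f := fun a => (B *ᵥ Pi.single b 1) a * (B *ᵥ Pi.single b 1) a)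
      (fun i _ => mul_self_nonneg _) (Finset.mem_univ a)
  have : (Pi.single b (1 : ℝ) : ι → ℝ) ⬝ᵥ Pi.single b 1 = 1 := by simp
  rw [this] at h1
  exact (sq_le_one_iff_abs_le_one _).1 (h3.trans h1)

/-- A strict contraction fixes no nonzero vector, so the determinant does not vanish. These matrices
form a compact set, on which `|det (1 - B)|` attains a positive minimum. -/
theorem exists_abs_det_one_sub_ge (ι : Type) [Fintype ι] [DecidableEq ι] {c : ℝ} (hc : 0 < c) :
    ∃ D : ℝ, 0 < D ∧ ∀ B : Matrix ι ι ℝ,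
      (∀ v : ι → ℝ, (B *ᵥ v) ⬝ᵥ (B *ᵥ v) ≤ (1 - c) * (v ⬝ᵥ v)) → D ≤ |(1 - B).det| := by
  set S : Set (Matrix ι ι ℝ) :=
    {B | ∀ v : ι → ℝ, (B *ᵥ v) ⬝ᵥ (B *ᵥ v) ≤ (1 - c) * (v ⬝ᵥ v)} with hS
  have hclosed : IsClosed S := by
    rw [hS, ofPred_forall]
    exact isClosed_iInter fun v => isClosed_le (by fun_prop) continuous_const
  have hcpt : IsCompact S := by
    refine IsCompact.of_isClosed_subset (isCompact_univ_pi fun _ : ι => isCompact_univ_pi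
      fun _ : ι => isCompact_Icc (a := (-1 : ℝ)) (b := 1)) hclosed fun B hB a _ b _ => ?_
    exact abs_le.1 (abs_le_one_of_energy_le (fun v => (hB v).trans
      (by nlinarith [dotProduct_self_nonneg_real v])) a b)
  rcases S.eq_empty_or_nonempty with hemp | hne
  -- The set is empty when `c > 1` and `ι` is nonempty; any positive constant then serves.
  · exact ⟨1, one_pos, fun B hB => absurd (show B ∈ S from hB) (by simp [hemp])⟩
  · obtain ⟨B₀, hB₀, hmin⟩ := hcpt.exists_isMinOn (f := fun B => |(1 - B).det|) hne
      (by fun_prop)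
    refine ⟨|(1 - B₀).det|, abs_pos.2 fun hdet => ?_, fun B hB => hmin hB⟩
    obtain ⟨v, hv, hBv⟩ := Matrix.exists_mulVec_eq_zero_iff.2 hdet
    rw [Matrix.sub_mulVec, Matrix.one_mulVec, sub_eq_zero] at hBv
    have h1 := hB₀ v
    rw [← hBv] at h1
    have h2 : 0 < v ⬝ᵥ v :=
      lt_of_le_of_ne (dotProduct_self_nonneg_real v) (fun h => hv (dotProduct_self_eq_zero.1 h.symm))
    nlinarith

/-- `Φ` solves the matrix equation `Φ̇ = -g Ω Ωᵀ Φ` on `[0, ∞)` with `Φ(0) = I`. -/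
def IsTransition (g : ℝ) (Ω : ℝ → ι → ℝ) (Φ : ℝ → Matrix ι ι ℝ) : Prop :=
  Φ 0 = 1 ∧ ∀ t : ℝ, 0 ≤ t → ∀ a b, HasDerivWithinAt (fun τ => Φ τ a b)
    ((-g • (Matrix.vecMulVec (Ω t) (Ω t) * Φ t)) a b) (Ici 0) t

variable {Φ : ℝ → Matrix ι ι ℝ}

theorem IsTransition.isGradientFlow (h : IsTransition g Ω Φ) (v : ι → ℝ) :
    IsGradientFlow g Ω (fun t => Φ t *ᵥ v) := fun t ht => by
  rw [hasDerivWithinAt_pi]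
  intro a
  have := HasDerivWithinAt.fun_sum (u := Finset.univ) fun b _ => (h.2 t ht a b).mul_const (v b)
  refine this.congr_deriv ?_
  have h1 : ∑ b, (-g • (Matrix.vecMulVec (Ω t) (Ω t) * Φ t)) a b * v b
      = ((-g • (Matrix.vecMulVec (Ω t) (Ω t) * Φ t)) *ᵥ v) a := rfl
  rw [h1, Matrix.smul_mulVec, ← Matrix.mulVec_mulVec, Matrix.vecMulVec_mulVec]
  simp only [Pi.smul_apply, smul_eq_mul, MulOpposite.smul_eq_mul_unop, MulOpposite.unop_op]
  ring

theorem IsTransition.energy_le (h : IsTransition g Ω Φ) (hg : 0 ≤ g) (v : ι → ℝ) {t : ℝ}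
    (ht : 0 ≤ t) : (Φ t *ᵥ v) ⬝ᵥ (Φ t *ᵥ v) ≤ v ⬝ᵥ v := by
  have := (h.isGradientFlow v).antitoneOn hg (mem_Ici.2 le_rfl) (mem_Ici.2 ht) ht
  simpa [h.1] using this

theorem IsTransition.abs_le_one (h : IsTransition g Ω Φ) (hg : 0 ≤ g) {t : ℝ} (ht : 0 ≤ t)
    (a b : ι) : |Φ t a b| ≤ 1 :=
  abs_le_one_of_energy_le (fun v => h.energy_le hg v ht) a b

/-- Uniqueness for the gradient flow, which comes from monotone energy and needs no Lipschitz
theory. -/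
theorem IsTransition.sub_eq (h : IsTransition g Ω Φ) (hg : 0 ≤ g) (he : IsGradientFlow g Ω e)
    {t : ℝ} (ht : 0 ≤ t) : e t = Φ t *ᵥ e 0 := by
  have := (he.sub (h.isGradientFlow (e 0))).eq_zero hg (by simp [h.1]) ht
  exact sub_eq_zero.1 this

end Gradient

/-! ### The linear regression equation -/

theorem intervalIntegrable_lowPass {lam : ℝ} {v : ℝ → ℝ} (hv : ContinuousOn v (Ici 0)) {t : ℝ}
    (ht : 0 ≤ t) : IntervalIntegrable (fun τ => lam * Real.exp (-lam * (t - τ)) * v τ)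
      MeasureTheory.volume 0 t := by
  refine ContinuousOn.intervalIntegrable ?_
  rw [uIcc_of_le ht]
  exact (Continuous.continuousOn (by fun_prop)).mul (hv.mono Icc_subset_Ici_self)

theorem lowPass_congr {lam : ℝ} {v w : ℝ → ℝ} (h : ∀ τ, 0 ≤ τ → v τ = w τ) {t : ℝ} (ht : 0 ≤ t) :
    lowPass lam v t = lowPass lam w t := by
  refine intervalIntegral.integral_congr fun τ hτ => ?_
  rw [uIcc_of_le ht] at hτ
  simp only [h τ hτ.1]

theorem lowPass_add {lam : ℝ} {v w : ℝ → ℝ} (hv : ContinuousOn v (Ici 0))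
    (hw : ContinuousOn w (Ici 0)) {t : ℝ} (ht : 0 ≤ t) :
    lowPass lam (fun τ => v τ + w τ) t = lowPass lam v t + lowPass lam w t := by
  unfold lowPass
  rw [← intervalIntegral.integral_add (intervalIntegrable_lowPass hv ht)
    (intervalIntegrable_lowPass hw ht)]
  simp only [mul_add]

theorem lowPass_dotProduct {lam : ℝ} {ι : Type} [Fintype ι] {v : ℝ → ι → ℝ} (c : ι → ℝ)
    (hv : ContinuousOn v (Ici 0)) {t : ℝ} (ht : 0 ≤ t) :
    lowPass lam (fun τ => v τ ⬝ᵥ c) t = (fun i => lowPass lam (fun τ => v τ i) t) ⬝ᵥ c := by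
  unfold lowPass
  simp only [dotProduct, Finset.mul_sum, ← intervalIntegral.integral_mul_const]
  rw [intervalIntegral.integral_finsetSum]
  · exact Finset.sum_congr rfl fun i _ => by simp only [mul_assoc]
  · intro i _
    have := (intervalIntegrable_lowPass (lam := lam) (continuousOn_pi.1 hv i) ht).mul_const (c i)
    simpa only [mul_assoc] using this

theorem continuousOn_lowPass {lam : ℝ} {v : ℝ → ℝ} (hv : ContinuousOn v (Ici 0)) :
    ContinuousOn (lowPass lam v) (Ici 0) := by
  -- Freezing `v` at its initial value for negative times gives a function continuous on the whole
  -- line; factoring `exp (-lam * t)` out of the kernel then leaves a plain primitive.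
  have hw : Continuous fun τ => v (max τ 0) :=
    hv.comp_continuous (by fun_prop) fun τ => mem_Ici.2 (le_max_right _ _)
  have hc : Continuous fun t => lam * Real.exp (-lam * t) *
      ∫ τ in (0 : ℝ)..t, Real.exp (lam * τ) * v (max τ 0) :=
    (by fun_prop : Continuous fun t => lam * Real.exp (-lam * t)).mul
      (intervalIntegral.continuous_primitive
        (fun a b => Continuous.intervalIntegrable
          ((by fun_prop : Continuous fun τ => Real.exp (lam * τ)).mul hw) a b) 0)
  refine hc.continuousOn.congr fun t ht => ?_
  change ∫ τ in (0 : ℝ)..t, lam * Real.exp (-lam * (t - τ)) * v τ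
    = lam * Real.exp (-lam * t) * ∫ τ in (0 : ℝ)..t, Real.exp (lam * τ) * v (max τ 0)
  rw [← intervalIntegral.integral_const_mul]
  refine intervalIntegral.integral_congr fun τ hτ => ?_
  rw [uIcc_of_le ht] at hτ
  simp only [max_eq_left hτ.1]
  rw [show -lam * (t - τ) = -lam * t + lam * τ by ring, Real.exp_add]
  ring

/-! ### Derivatives of smooth functions along a trajectory -/

section Chain

variable {n : ℕ} {F : Type*} [NormedAddCommGroup F] [NormedSpace ℝ F] {ψ : Vec n → F}
  {x x' : ℝ → Vec n}

theorem derivWithin_comp_eq (hψ : ContDiff ℝ ∞ ψ)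
    (hx : ∀ t, 0 ≤ t → HasDerivWithinAt x (x' t) (Ici 0) t) {t : ℝ} (ht : 0 ≤ t) :
    HasDerivWithinAt (fun τ => ψ (x τ)) (fderiv ℝ ψ (x t) (x' t)) (Ici 0) t :=
  ((hψ.differentiable (by simp)).differentiableAt.hasFDerivAt).comp_hasDerivWithinAt t (hx t ht)

theorem continuousOn_derivWithin_comp (hψ : ContDiff ℝ ∞ ψ)
    (hx : ∀ t, 0 ≤ t → HasDerivWithinAt x (x' t) (Ici 0) t) (hx' : ContinuousOn x' (Ici 0)) :
    ContinuousOn (derivWithin (fun τ => ψ (x τ)) (Ici 0)) (Ici 0) := by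
  have hxc : ContinuousOn x (Ici 0) := fun t ht => (hx t ht).continuousWithinAt
  have h1 : ContinuousOn (fun t => fderiv ℝ ψ (x t) (x' t)) (Ici 0) :=
    ((hψ.continuous_fderiv (by simp)).comp_continuousOn hxc).clm_apply hx'
  exact h1.congr fun t ht =>
    (derivWithin_comp_eq hψ hx ht).derivWithin (uniqueDiffOn_Ici 0 t ht)

end Chain

variable {n m k q ps pS pd : ℕ}

/-! ### Closed-loop signals: continuity, power balance and regression -/

namespace Setup

variable {A : Setup n m k q ps pS pd} {w : Evolution n q ps pS pd}

theorem continuousOn_u (hβ : IsControlLaw A.β) (hx : ContinuousOn w.x (Ici 0))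
    (hθ : ContinuousOn w.θh (Ici 0)) : ContinuousOn (A.u w) (Ici 0) :=
  hβ.1.continuousOn.comp (hx.prodMk (hθ.prodMk continuousOn_id)) fun _ ht => ht

theorem continuousOn_sumElim {α : Type*} [TopologicalSpace α] {s : Set α} {ι κ : Type*}
    {u : α → ι → ℝ} {v : α → κ → ℝ} (hu : ContinuousOn u s) (hv : ContinuousOn v s) :
    ContinuousOn (fun t => Sum.elim (u t) (v t) : α → ι ⊕ κ → ℝ) s :=
  continuousOn_pi.2 fun i => by
    cases i with
    | inl i => exact continuousOn_pi.1 hu i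
    | inr i => exact continuousOn_pi.1 hv i

theorem continuousOn_mulVec {α : Type*} [TopologicalSpace α] {s : Set α} {ι κ : Type*} [Fintype κ]
    {B : α → Matrix ι κ ℝ} {v : α → κ → ℝ} (hB : ∀ a b, ContinuousOn (fun t => B t a b) s)
    (hv : ContinuousOn v s) : ContinuousOn (fun t => B t *ᵥ v t) s :=
  continuousOn_pi.2 fun a => continuousOn_finsetSum _ fun b _ =>
    (hB a b).mul (continuousOn_pi.1 hv b)

theorem IsTrajectory.continuousOn_x (hw : A.IsTrajectory w) : ContinuousOn w.x (Ici 0) :=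
  fun t ht => (hw.2 t ht).1.continuousWithinAt

theorem IsTrajectory.continuousOn_θh (hw : A.IsTrajectory w) : ContinuousOn w.θh (Ici 0) :=
  fun t ht => (hw.2 t ht).2.2.2.continuousWithinAt

theorem IsTrajectory.continuousOn_up (hw : A.IsTrajectory w) (hβ : IsControlLaw A.β)
    (hE : IsSource A.E) : ContinuousOn (A.up w) (Ici 0) :=
  continuousOn_sumElim (continuousOn_u hβ hw.continuousOn_x hw.continuousOn_θh) hE.1

theorem IsTrajectory.continuousOn_yp (hw : A.IsTrajectory w) (hβ : IsControlLaw A.β)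
    (hE : IsSource A.E) : ContinuousOn (A.yp w) (Ici 0) := by
  have hx := hw.continuousOn_x.prodMk (continuousOn_const (c := A.θ))
  exact (A.pl.smooth_h.continuous.comp_continuousOn hx).add (continuousOn_mulVec
    (fun a b => (A.pl.smooth_j a b).continuous.comp_continuousOn hx) (hw.continuousOn_up hβ hE))

theorem IsTrajectory.continuousOn_velocity (hw : A.IsTrajectory w) (hβ : IsControlLaw A.β)
    (hE : IsSource A.E) : ContinuousOn
      (fun t => A.pl.f (w.x t) A.θ + A.pl.g (w.x t) A.θ *ᵥ A.up w t) (Ici 0) := by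
  have hx := hw.continuousOn_x.prodMk (continuousOn_const (c := A.θ))
  exact (A.pl.smooth_f.continuous.comp_continuousOn hx).add (continuousOn_mulVec
    (fun a b => (A.pl.smooth_g a b).continuous.comp_continuousOn hx) (hw.continuousOn_up hβ hE))

theorem IsTrajectory.continuousOn_Ω (hw : A.IsTrajectory w) (hβ : IsControlLaw A.β)
    (hE : IsSource A.E) : ContinuousOn (A.Ω w) (Ici 0) := by
  have hx := hw.continuousOn_x
  have hv := hw.continuousOn_velocity hβ hE
  have huy := (hw.continuousOn_up hβ hE).prodMk (hw.continuousOn_yp hβ hE)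
  refine continuousOn_sumElim (continuousOn_pi.2 fun i => ?_)
    (continuousOn_sumElim (continuousOn_pi.2 fun i => ?_) (continuousOn_pi.2 fun i => ?_))
  · exact (continuousOn_lowPass (continuousOn_pi.1
      (A.Q.smooth_φs.continuous.comp_continuousOn huy) i)).neg
  · exact continuousOn_lowPass (continuousOn_derivWithin_comp
      (ψ := fun y => A.Q.φS y i) ((contDiff_pi.1 A.Q.smooth_φS) i) (fun t ht => (hw.2 t ht).1) hv)
  · exact continuousOn_lowPass (continuousOn_pi.1
      (A.Q.smooth_φd.continuous.comp_continuousOn hx) i)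

/-- The storage function is differentiated along the trajectory in two ways, by the dissipation
equality and term by term in its separable form; one-sided derivatives on `[0, ∞)` are unique. -/
theorem IsTrajectory.powerBalance (hw : A.IsTrajectory w)
    {s : PVec m k → PVec m k → Vec q → ℝ} {S d : Vec n → Vec q → ℝ}
    (hdiss : Dissipative A.pl A.θ s S d) (hrep : Represents A.Q s S d) {t : ℝ} (ht : 0 ≤ t) :
    (A.Q.bs (A.up w t) (A.yp w t) - A.Q.bd (w.x t)) +
        A.Q.φs (A.up w t) (A.yp w t) ⬝ᵥ A.Q.Gs A.θ
      = derivWithin (fun τ => A.Q.bS (w.x τ)) (Ici 0) t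
        + ((fun i => derivWithin (fun τ => A.Q.φS (w.x τ) i) (Ici 0) t) ⬝ᵥ A.Q.GS A.θ
          + A.Q.φd (w.x t) ⬝ᵥ A.Q.Gd A.θ) := by
  have hS : (fun y => S y A.θ) = fun y => A.Q.φS y ⬝ᵥ A.Q.GS A.θ + A.Q.bS y :=
    funext fun y => hrep.2.1 y A.θ
  have hx : ∀ t, 0 ≤ t → HasDerivWithinAt w.x
    (A.pl.f (w.x t) A.θ + A.pl.g (w.x t) A.θ *ᵥ A.up w t) (Ici 0) t := fun t ht => (hw.2 t ht).1
  have hφ : ∀ i, ContDiff ℝ ∞ fun y => A.Q.φS y i := contDiff_pi.1 A.Q.smooth_φS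
  have hsm : ContDiff ℝ ∞ (fun y => A.Q.φS y ⬝ᵥ A.Q.GS A.θ + A.Q.bS y) :=
    (ContDiff.sum fun i _ => (hφ i).mul contDiff_const).add A.Q.smooth_bS
  have h1 := derivWithin_comp_eq hsm hx ht
  rw [← hS, hdiss.2.2 (w.x t) (A.up w t)] at h1
  have hbS := (derivWithin_comp_eq A.Q.smooth_bS hx ht).differentiableWithinAt.hasDerivWithinAt
  have hφS := fun i => (derivWithin_comp_eq (hφ i) hx ht).differentiableWithinAt.hasDerivWithinAt
  have h2 := (HasDerivWithinAt.fun_sum (u := Finset.univ) fun i _ =>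
    (hφS i).mul_const (A.Q.GS A.θ i)).add hbS
  have h4 := (uniqueDiffOn_Ici (0 : ℝ) t ht).eq_deriv _ h1 h2
  rw [hrep.1, hrep.2.2] at h4
  change -_ + (A.Q.φs (A.up w t) (A.yp w t) ⬝ᵥ _ + A.Q.bs (A.up w t) (A.yp w t)) = _ at h4
  simp only [dotProduct] at h4 ⊢
  linarith

/-- The linear regression equation `Y = Ωᵀ 𝒢(θ)`. -/
theorem IsTrajectory.regression (hw : A.IsTrajectory w) (hβ : IsControlLaw A.β)
    (hE : IsSource A.E) {s : PVec m k → PVec m k → Vec q → ℝ} {S d : Vec n → Vec q → ℝ}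
    (hdiss : Dissipative A.pl A.θ s S d) (hrep : Represents A.Q s S d) {t : ℝ} (ht : 0 ≤ t) :
    A.Y w t = A.Ω w t ⬝ᵥ A.Q.G A.θ := by
  have hx := hw.continuousOn_x
  have hv := hw.continuousOn_velocity hβ hE
  have huy := (hw.continuousOn_up hβ hE).prodMk (hw.continuousOn_yp hβ hE)
  have hxd : ∀ t, 0 ≤ t → HasDerivWithinAt w.x
    (A.pl.f (w.x t) A.θ + A.pl.g (w.x t) A.θ *ᵥ A.up w t) (Ici 0) t := fun t ht => (hw.2 t ht).1
  have hφs : ContinuousOn (fun τ => A.Q.φs (A.up w τ) (A.yp w τ)) (Ici 0) :=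
    A.Q.smooth_φs.continuous.comp_continuousOn huy
  have hφd : ContinuousOn (fun τ => A.Q.φd (w.x τ)) (Ici 0) :=
    A.Q.smooth_φd.continuous.comp_continuousOn hx
  have hb : ContinuousOn (fun τ => A.Q.bs (A.up w τ) (A.yp w τ) - A.Q.bd (w.x τ)) (Ici 0) :=
    (A.Q.smooth_bs.continuous.comp_continuousOn huy).sub
      (A.Q.smooth_bd.continuous.comp_continuousOn hx)
  have hbS : ContinuousOn (derivWithin (fun τ => A.Q.bS (w.x τ)) (Ici 0)) (Ici 0) :=
    continuousOn_derivWithin_comp A.Q.smooth_bS hxd hv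
  have hφS : ContinuousOn (fun τ i => derivWithin (fun τ => A.Q.φS (w.x τ) i) (Ici 0) τ) (Ici 0) :=
    continuousOn_pi.2 fun i => continuousOn_derivWithin_comp
      (ψ := fun y => A.Q.φS y i) ((contDiff_pi.1 A.Q.smooth_φS) i) hxd hv
  -- Both sides of the power balance pass through the same linear filter. Derivatives are filtered
  -- directly with zero initial state, so the identity has no exponentially decaying remainder.
  have key := lowPass_congr (lam := A.lam) (fun τ hτ => hw.powerBalance hdiss hrep hτ) ht
  rw [lowPass_add hb (continuousOn_dotProduct hφs continuousOn_const) ht,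
    lowPass_add hbS ((continuousOn_dotProduct hφS continuousOn_const).fun_add
      (continuousOn_dotProduct hφd continuousOn_const)) ht,
    lowPass_add (continuousOn_dotProduct hφS continuousOn_const)
      (continuousOn_dotProduct hφd continuousOn_const) ht,
    lowPass_dotProduct _ hφs ht, lowPass_dotProduct _ hφS ht, lowPass_dotProduct _ hφd ht] at key
  have h1 : A.Ω w t ⬝ᵥ A.Q.G A.θ
      = -((fun i => lowPass A.lam (fun τ => A.Q.φs (A.up w τ) (A.yp w τ) i) t) ⬝ᵥ A.Q.Gs A.θ)
        + ((fun i => lowPass A.lam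
            (fun τ => derivWithin (fun τ => A.Q.φS (w.x τ) i) (Ici 0) τ) t) ⬝ᵥ A.Q.GS A.θ
          + (fun i => lowPass A.lam (fun τ => A.Q.φd (w.x τ) i) t) ⬝ᵥ A.Q.Gd A.θ) := by
    rw [← neg_dotProduct]
    simp only [dotProduct, Fintype.sum_sum_type]
    rfl
  rw [h1]
  change lowPass A.lam (fun τ => A.Q.bs (A.up w τ) (A.yp w τ) - A.Q.bd (w.x τ)) t
    - lowPass A.lam (derivWithin (fun τ => A.Q.bS (w.x τ)) (Ici 0)) t = _
  linarith

theorem IsTrajectory.isTransition (hw : A.IsTrajectory w) : IsTransition A.γg (A.Ω w) w.Φ :=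
  ⟨hw.1, fun t ht => (hw.2 t ht).2.2.1⟩

theorem IsTrajectory.isGradientFlow (hw : A.IsTrajectory w)
    (hY : ∀ t, 0 ≤ t → A.Y w t = A.Ω w t ⬝ᵥ A.Q.G A.θ) :
    IsGradientFlow A.γg (A.Ω w) (fun t => w.θg t - A.Q.G A.θ) := fun t ht => by
  refine ((hw.2 t ht).2.1.sub_const (A.Q.G A.θ)).congr_deriv ?_
  rw [hY t ht, dotProduct_sub]
  congr 1
  ring

/-- The mixed regression equation `𝒴 = Δ 𝒢(θ)`. -/
theorem IsTrajectory.calY_eq (hw : A.IsTrajectory w) (hγg : 0 < A.γg)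
    (hY : ∀ t, 0 ≤ t → A.Y w t = A.Ω w t ⬝ᵥ A.Q.G A.θ) {t : ℝ} (ht : 0 ≤ t) :
    calY w t = Δ w t • A.Q.G A.θ := by
  have h1 := hw.isTransition.sub_eq hγg.le (hw.isGradientFlow hY) ht
  -- The known part `Φ θ̂_g(0)` is removed, leaving a square linear system for `𝒢(θ)` that the
  -- adjugate decouples into scalar equations.
  have h2 : w.θg t - w.Φ t *ᵥ w.θg 0 = (1 - w.Φ t) *ᵥ A.Q.G A.θ := by
    rw [Matrix.mulVec_sub] at h1
    rw [Matrix.sub_mulVec, Matrix.one_mulVec]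
    linear_combination (exp := 1) h1
  rw [calY, h2, Matrix.mulVec_mulVec, Matrix.adjugate_mul, Matrix.smul_mulVec, Matrix.one_mulVec]
  rfl

/-- Interval excitation keeps `Δ` away from zero after the interval of excitation. -/
theorem exists_le_abs_Δ (A : Setup n m k q ps pS pd) (hγg : 0 < A.γg) (hβ : IsControlLaw A.β)
    (hE : IsSource A.E) {M C tc : ℝ} (hC : 0 < C) (htc : 0 < tc) :
    ∃ D : ℝ, 0 < D ∧ ∀ w, A.IsTrajectory w → BoundedExciting M C tc (A.Ω w) →
      ∀ t, tc ≤ t → D ≤ |Δ w t| := by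
  obtain ⟨c, hc, H⟩ := exists_contraction_of_boundedExciting (Reg ps pS pd) (M := M) hγg hC htc
  obtain ⟨D, hD, H'⟩ := exists_abs_det_one_sub_ge (Reg ps pS pd) hc
  refine ⟨D, hD, fun w hw hex t ht => H' _ fun v => ?_⟩
  have := H _ _ (hw.continuousOn_Ω hβ hE) hex (hw.isTransition.isGradientFlow v) t ht
  simpa [hw.1] using this

/-- After `𝒴 = Δ 𝒢(θ)` is substituted, the trajectory enters only through the nonnegative factor
`Δ²`. -/
theorem IsTrajectory.estimatorField_eq (hw : A.IsTrajectory w) (hγg : 0 < A.γg)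
    (hY : ∀ t, 0 ≤ t → A.Y w t = A.Ω w t ⬝ᵥ A.Q.G A.θ) {t : ℝ} (ht : 0 ≤ t) (ϑ : Vec q) :
    A.estimatorField w t ϑ
      = (-(A.γ * Δ w t ^ 2)) • (A.P *ᵥ (A.T *ᵥ A.Q.G ϑ - A.T *ᵥ A.Q.G A.θ)) := by
  rw [estimatorField, hw.calY_eq hγg hY ht, ← smul_sub, smul_smul, Matrix.mulVec_smul, smul_smul,
    ← Matrix.mulVec_mulVec, ← Matrix.mulVec_sub, ← neg_sub (A.Q.G ϑ), Matrix.mulVec_neg,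
    Matrix.mulVec_neg, smul_neg, neg_smul]
  congr 2
  ring

end Setup

/-! ### The closed-loop vector field -/

theorem norm_sumElim_le {ι κ : Type*} [Fintype ι] [Fintype κ] {u : ι → ℝ} {v : κ → ℝ} {B : ℝ}
    (hB : 0 ≤ B) (hu : ‖u‖ ≤ B) (hv : ‖v‖ ≤ B) : ‖(Sum.elim u v : ι ⊕ κ → ℝ)‖ ≤ B := by
  refine (pi_norm_le_iff_of_nonneg hB).2 fun i => ?_
  cases i with
  | inl i => exact (norm_le_pi_norm u i).trans hu
  | inr i => exact (norm_le_pi_norm v i).trans hv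

/-- Coordinatewise truncation to the ball of radius `R` for the sup norm. -/
def truncate {n : ℕ} (R : ℝ) (x : Vec n) : Vec n := fun i => max (-R) (min (x i) R)

section Truncate

variable {n : ℕ} {R : ℝ}

theorem norm_truncate_le (hR : 0 ≤ R) (x : Vec n) : ‖truncate R x‖ ≤ R :=
  (pi_norm_le_iff_of_nonneg hR).2 fun i =>
    abs_le.2 ⟨le_max_left _ _, max_le (by linarith) (min_le_right _ _)⟩

theorem truncate_eq_self {x : Vec n} (hx : ‖x‖ ≤ R) : truncate R x = x := funext fun i => by
  obtain ⟨h1, h2⟩ := abs_le.1 ((norm_le_pi_norm x i).trans hx)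
  rw [truncate, min_eq_left h2, max_eq_right h1]

theorem norm_truncate_sub_le (x y : Vec n) : ‖truncate R x - truncate R y‖ ≤ ‖x - y‖ := by
  refine (pi_norm_le_iff_of_nonneg (norm_nonneg _)).2 fun i => ?_
  have h := ((LipschitzWith.id (α := ℝ)).min_const R).const_max (-R) |>.dist_le_mul (x i) (y i)
  rw [NNReal.coe_one, one_mul] at h
  exact h.trans (norm_le_pi_norm (x - y) i)

end Truncate

variable {n m k q ps pS pd : ℕ}

theorem IsControlLaw.exists_bound {β : Vec n → Vec q → ℝ → Vec m} (hβ : IsControlLaw β) (R : ℝ) :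
    ∃ L : ℝ, 0 ≤ L ∧ ∀ (t : ℝ) (x x' : Vec n) (ϑ ϑ' : Vec q), 0 ≤ t →
      ‖x‖ ≤ R → ‖x'‖ ≤ R → ‖ϑ‖ ≤ R → ‖ϑ'‖ ≤ R →
      ‖β x ϑ t‖ ≤ L ∧ ‖β x ϑ t - β x' ϑ' t‖ ≤ L * (‖x - x'‖ + ‖ϑ - ϑ'‖) := by
  obtain ⟨L, hL⟩ := hβ.2 R
  refine ⟨max L 0, le_max_right _ _, fun t x x' ϑ ϑ' ht h1 h2 h3 h4 => ?_⟩
  obtain ⟨h5, h6⟩ := hL t x x' ϑ ϑ' ht h1 h2 h3 h4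
  exact ⟨h5.trans (le_max_left _ _),
    h6.trans (mul_le_mul_of_nonneg_right (le_max_left _ _) (by positivity))⟩

namespace Setup

variable (A : Setup n m k q ps pS pd)

/-- Vector field of the plant under the control `u = β(x, ϑ, t)`. -/
def closedField (t : ℝ) (x : Vec n) (ϑ : Vec q) : Vec n :=
  A.pl.f x A.θ + A.pl.g x A.θ *ᵥ Sum.elim (A.β x ϑ t) (A.E t)

theorem contDiff_portField : ContDiff ℝ ∞
    (fun z : Vec n × PVec m k => A.pl.f z.1 A.θ + A.pl.g z.1 A.θ *ᵥ z.2) := by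
  have h : ContDiff ℝ ∞ (fun z : Vec n × PVec m k => (z.1, A.θ)) := by fun_prop
  refine (A.pl.smooth_f.comp h).add (contDiff_pi.2 fun a => ?_)
  change ContDiff ℝ ∞ fun z : Vec n × PVec m k => ∑ b, A.pl.g z.1 A.θ a b * z.2 b
  refine ContDiff.sum fun b _ => ?_
  exact ((A.pl.smooth_g a b).comp h).mul (by fun_prop)

variable {A}

/-- With the port vector as an independent variable the plant field is smooth and autonomous, hence
bounded and Lipschitz on a ball. Time enters only through `β` and `E`, whose bounds are uniform in
`t`. -/
theorem exists_closedField_bound (hβ : IsControlLaw A.β) (hE : IsSource A.E) (R : ℝ) :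
    ∃ K : NNReal, ∃ B : NNReal, ∀ (t : ℝ) (x x' : Vec n) (ϑ ϑ' : Vec q), 0 ≤ t →
      ‖x‖ ≤ R → ‖x'‖ ≤ R → ‖ϑ‖ ≤ R → ‖ϑ'‖ ≤ R →
      ‖A.closedField t x ϑ‖ ≤ B ∧
      ‖A.closedField t x ϑ - A.closedField t x' ϑ'‖ ≤ K * (‖x - x'‖ + ‖ϑ - ϑ'‖) := by
  obtain ⟨L, hL0, hL⟩ := hβ.exists_bound R
  obtain ⟨BE, hBE⟩ := hE.2
  set r := max R (max L BE) with hr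
  obtain ⟨K, hK⟩ := (A.contDiff_portField.contDiffOn
    (s := Metric.closedBall 0 r)).exists_lipschitzOnWith (by simp) (convex_closedBall _ _)
    (isCompact_closedBall _ _)
  obtain ⟨B, hB⟩ := (isCompact_closedBall (0 : Vec n × PVec m k) r).exists_bound_of_continuousOn
    A.contDiff_portField.continuous.continuousOn
  have hr0 : 0 ≤ r := hL0.trans ((le_max_left _ _).trans (le_max_right _ _))
  have hmem : ∀ (t : ℝ) (x : Vec n) (ϑ : Vec q), 0 ≤ t → ‖x‖ ≤ R → ‖ϑ‖ ≤ R →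
      (x, (Sum.elim (A.β x ϑ t) (A.E t) : PVec m k)) ∈
        Metric.closedBall (0 : Vec n × PVec m k) r := fun t x ϑ ht hx hϑ => by
    rw [mem_closedBall_zero_iff]
    exact max_le (hx.trans (le_max_left _ _)) (norm_sumElim_le hr0
      ((hL t x x ϑ ϑ ht hx hx hϑ hϑ).1.trans ((le_max_left _ _).trans (le_max_right _ _)))
      ((hBE t ht).trans ((le_max_right _ _).trans (le_max_right _ _))))
  refine ⟨K * (1 + L.toNNReal), B.toNNReal, fun t x x' ϑ ϑ' ht hx hx' hϑ hϑ' => ⟨?_, ?_⟩⟩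
  · exact (hB _ (hmem t x ϑ ht hx hϑ)).trans (Real.le_coe_toNNReal B)
  · have h1 := hK.dist_le_mul _ (hmem t x ϑ ht hx hϑ) _ (hmem t x' ϑ' ht hx' hϑ')
    rw [dist_eq_norm, dist_eq_norm] at h1
    refine h1.trans ?_
    push_cast
    rw [mul_assoc, Real.coe_toNNReal L hL0]
    refine mul_le_mul_of_nonneg_left ?_ K.2
    have h2 := (hL t x x' ϑ ϑ' ht hx hx' hϑ hϑ').2
    have h3 : 0 ≤ ‖x - x'‖ := norm_nonneg _
    have h4 : 0 ≤ ‖ϑ - ϑ'‖ := norm_nonneg _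
    have h5 : 0 ≤ L * (‖x - x'‖ + ‖ϑ - ϑ'‖) := by positivity
    refine max_le (by change ‖x - x'‖ ≤ _; linarith) ?_
    have h6 : (Sum.elim (A.β x ϑ t) (A.E t) : PVec m k) - Sum.elim (A.β x' ϑ' t) (A.E t)
        = Sum.elim (A.β x ϑ t - A.β x' ϑ' t) (0 : Vec k) := by
      ext i
      cases i <;> simp
    change ‖(Sum.elim (A.β x ϑ t) (A.E t) : PVec m k) - Sum.elim (A.β x' ϑ' t) (A.E t)‖ ≤ _
    rw [h6]
    exact norm_sumElim_le (by positivity) (by linarith) (by rw [norm_zero]; positivity)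

theorem continuousOn_closedField (hβ : IsControlLaw A.β) (hE : IsSource A.E) (x : Vec n)
    (ϑ : Vec q) : ContinuousOn (fun t => A.closedField t x ϑ) (Ici 0) :=
  continuousOn_const.add (continuousOn_mulVec (fun _ _ => continuousOn_const)
    (continuousOn_sumElim (hβ.1.continuousOn.comp (f := fun t : ℝ => (x, ϑ, t))
      (by fun_prop) fun _ ht => ht) hE.1))

theorem errorField_fst (w : Evolution n q ps pS pd) (t : ℝ) (z : Vec n × Vec q) :
    (A.errorField w t z).1
      = A.closedField t (z.1 + A.xs t) (z.2 + A.θ) - derivWithin A.xs (Ici 0) t := by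
  have h : (Sum.elim (A.β (z.1 + A.xs t) (z.2 + A.θ) t) (A.E t) : PVec m k)
      = Sum.elim (A.β (z.1 + A.xs t) A.θ t) (A.E t) +
        Sum.elim (A.β (z.1 + A.xs t) (z.2 + A.θ) t - A.β (z.1 + A.xs t) A.θ t) (0 : Vec k) := by
    ext i
    cases i <;> simp
  rw [closedField, h, Matrix.mulVec_add]
  simp only [errorField, nominalField, perturbation]
  abel

/-- The nominal error dynamics are Lipschitz near the origin, and the parameter error perturbs them
proportionally, uniformly in time. -/
theorem exists_nominalField_lipschitz (hβ : IsControlLaw A.β) (hE : IsSource A.E)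
    (hxs : IsReference A.xs) : ∃ K : NNReal,
      (∀ t : ℝ, 0 ≤ t → LipschitzOnWith K (nominalField A.pl A.θ A.E A.β A.xs t)
        (Metric.closedBall 0 1)) ∧
      ∀ (w : Evolution n q ps pS pd) (t : ℝ), 0 ≤ t → ∀ z : Vec n × Vec q, ‖z.1‖ ≤ 1 → ‖z.2‖ ≤ 1 →
        ‖(A.errorField w t z).1 - nominalField A.pl A.θ A.E A.β A.xs t z.1‖ ≤ K * ‖z.2‖ := by
  obtain ⟨B, hB⟩ := hxs.2
  obtain ⟨K, _, hK⟩ := exists_closedField_bound hβ hE (1 + max B ‖A.θ‖)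
  have hx : ∀ t, 0 ≤ t → ∀ ξ : Vec n, ‖ξ‖ ≤ 1 → ‖ξ + A.xs t‖ ≤ 1 + max B ‖A.θ‖ :=
    fun t ht ξ hξ => (norm_add_le _ _).trans
      (add_le_add hξ ((hB t ht).1.trans (le_max_left _ _)))
  have hϑ : ∀ η : Vec q, ‖η‖ ≤ 1 → ‖η + A.θ‖ ≤ 1 + max B ‖A.θ‖ :=
    fun η hη => (norm_add_le _ _).trans (add_le_add hη (le_max_right _ _))
  have hθ : ‖A.θ‖ ≤ 1 + max B ‖A.θ‖ := by simpa using hϑ 0 (by simp)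
  refine ⟨K, fun t ht => LipschitzOnWith.of_dist_le_mul fun ξ hξ ξ' hξ' => ?_,
    fun w t ht z hz1 hz2 => ?_⟩
  · rw [mem_closedBall_zero_iff] at hξ hξ'
    have h := (hK t _ _ _ _ ht (hx t ht ξ hξ) (hx t ht ξ' hξ') hθ hθ).2
    rw [sub_self, norm_zero, add_zero, add_sub_add_right_eq_sub] at h
    rw [dist_eq_norm, dist_eq_norm]
    refine le_trans (le_of_eq ?_) h
    congr 1
    exact sub_sub_sub_cancel_right _ _ _
  · have h := (hK t _ _ _ _ ht (hx t ht _ hz1) (hx t ht _ hz1) (hϑ _ hz2) hθ).2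
    rw [sub_self, norm_zero, zero_add, add_sub_cancel_right] at h
    rw [errorField_fst]
    refine le_trans (le_of_eq ?_) h
    congr 1
    exact sub_sub_sub_cancel_right _ _ _

/-- Truncating the state makes the field globally Lipschitz and bounded, so Picard–Lindelöf reaches
any horizon. Stability then keeps the error below `1`, where the truncation is inactive. -/
theorem locallySolvable_nominalField (hβ : IsControlLaw A.β) (hE : IsSource A.E)
    (hxs : IsReference A.xs) (hstab : IsUAS (nominalField A.pl A.θ A.E A.β A.xs)) :
    LocallySolvable (nominalField A.pl A.θ A.E A.β A.xs) := by
  obtain ⟨B, hB⟩ := hxs.2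
  set R := 1 + max B ‖A.θ‖ with hR
  have hθR : ‖A.θ‖ ≤ R := by linarith [le_max_right B ‖A.θ‖]
  have hR0 : 0 ≤ R := (norm_nonneg _).trans hθR
  obtain ⟨K, L, hK⟩ := exists_closedField_bound hβ hE R
  obtain ⟨δ, hδ, hst⟩ := hstab.stable one_pos
  refine ⟨min δ 1, by positivity, fun t₀ T h₀ hT ξ₀ hξ₀ => ?_⟩
  have hI : ∀ t ∈ Icc t₀ (t₀ + T), 0 ≤ t := fun t ht => h₀.trans ht.1
  -- The equation is solved for the plant state rather than the error: the derivative of the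
  -- reference is not assumed continuous in time.
  have hpl : IsPicardLindelof (fun t x => A.closedField t (truncate R x) A.θ)
      (⟨t₀, le_rfl, by linarith⟩ : Icc t₀ (t₀ + T)) (ξ₀ + A.xs t₀) (L * T.toNNReal) 0 L K := by
    refine ⟨fun t ht => LipschitzOnWith.of_dist_le_mul fun x _ y _ => ?_, fun x _ => ?_,
      fun t ht x _ => ?_, ?_⟩
    · rw [dist_eq_norm, dist_eq_norm]
      have h := (hK t _ _ _ _ (hI t ht) (norm_truncate_le hR0 x) (norm_truncate_le hR0 y)
        hθR hθR).2
      rw [sub_self, norm_zero, add_zero] at h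
      exact h.trans (mul_le_mul_of_nonneg_left (norm_truncate_sub_le x y) K.2)
    · exact (continuousOn_closedField hβ hE _ _).mono hI
    · exact (hK t _ _ _ _ (hI t ht) (norm_truncate_le hR0 x) (norm_truncate_le hR0 x) hθR hθR).1
    · simp [hT]
  obtain ⟨y, hy0, hy⟩ := hpl.exists_eq_forall_mem_Icc_hasDerivWithinAt₀
  have hd : ∀ t ∈ Icc t₀ (t₀ + T), HasDerivWithinAt (fun t => y t - A.xs t)
      (A.closedField t (truncate R (y t)) A.θ - derivWithin A.xs (Ici 0) t)
      (Icc t₀ (t₀ + T)) t := fun t ht =>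
    (hy t ht).sub ((hxs.1 t (hI t ht)).hasDerivWithinAt.mono hI)
  have hsol : ∀ t ∈ Icc t₀ (t₀ + T), (∀ s ∈ Icc t₀ t, ‖y s - A.xs s‖ ≤ 1) →
      IsSolution (nominalField A.pl A.θ A.E A.β A.xs) t₀ t (fun t => y t - A.xs t) := by
    intro t ht hs s hst
    have hs' : s ∈ Icc t₀ (t₀ + T) := ⟨hst.1, hst.2.trans ht.2⟩
    have h1 : ‖y s‖ ≤ R := by
      have h2 := norm_add_le (y s - A.xs s) (A.xs s)
      rw [sub_add_cancel] at h2
      linarith [hs s hst, (hB s (hI s hs')).1, le_max_left B ‖A.θ‖]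
    refine ((hd s hs').mono (Icc_subset_Icc_right ht.2)).congr_deriv ?_
    rw [truncate_eq_self h1, nominalField, closedField, sub_add_cancel]
  have h0 : y t₀ - A.xs t₀ = ξ₀ := by rw [hy0, add_sub_cancel_right]
  have hlt := lt_of_forall_le_imp_lt (φ := fun t => ‖y t - A.xs t‖) (c := 1)
    (fun t ht => (hd t ht).continuousWithinAt.norm)
    (by rw [h0]; exact hξ₀.trans_le (min_le_right _ _))
    fun t ht hs => hst t₀ t h₀ _ (hsol t ht hs)
      (by change ‖y t₀ - A.xs t₀‖ < δ; rw [h0]; exact hξ₀.trans_le (min_le_left _ _))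
      t ⟨ht.1, le_rfl⟩
  exact ⟨fun t => y t - A.xs t,
    hsol (t₀ + T) ⟨by linarith, le_rfl⟩ fun s hs => (hlt s hs).le, h0⟩

end Setup

/-! ### Decay of the parameter error -/

theorem norm_sq_le_dotProduct_self {ι : Type} [Fintype ι] (v : ι → ℝ) : ‖v‖ ^ 2 ≤ v ⬝ᵥ v := by
  have h : ‖v‖ ≤ √(v ⬝ᵥ v) := (pi_norm_le_iff_of_nonneg (Real.sqrt_nonneg _)).2 fun i =>
    Real.abs_le_sqrt (by
      rw [sq]
      exact Finset.single_le_sum (f := fun i => v i * v i) (fun i _ => mul_self_nonneg _)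
        (Finset.mem_univ i))
  calc ‖v‖ ^ 2 ≤ √(v ⬝ᵥ v) ^ 2 := by gcongr
    _ = v ⬝ᵥ v := Real.sq_sqrt (dotProduct_self_nonneg_real v)

/-- The factor `q + 1` is a crude substitute for `√q`, positive also for `q = 0`. -/
theorem dotProduct_self_le {q : ℕ} (v : Vec q) : v ⬝ᵥ v ≤ ((q + 1) * ‖v‖) ^ 2 := by
  have h := abs_dotProduct_le (v := v) (w := v) (fun i => norm_le_pi_norm v i)
    (fun i => norm_le_pi_norm v i) (norm_nonneg v)
  rw [Fintype.card_fin] at h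
  refine (le_abs_self _).trans (h.trans ?_)
  have h1 : (0 : ℝ) ≤ q := q.cast_nonneg
  have h2 := sq_nonneg ‖v‖
  nlinarith [mul_nonneg h1 h2, mul_nonneg (mul_nonneg h1 h1) h2]

/-- The integrating factor makes `V t * exp (κ * (t - a))` antitone. -/
theorem mul_exp_le_of_hasDerivWithinAt {V V' : ℝ → ℝ} {κ a b : ℝ} (hab : a ≤ b)
    (hV : ∀ t ∈ Icc a b, HasDerivWithinAt V (V' t) (Icc a b) t)
    (h : ∀ t ∈ Icc a b, V' t ≤ -(κ * V t)) : V b * Real.exp (κ * (b - a)) ≤ V a := by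
  have hd : ∀ t ∈ Icc a b, HasDerivWithinAt (fun t => V t * Real.exp (κ * (t - a)))
      (V' t * Real.exp (κ * (t - a)) + V t * (Real.exp (κ * (t - a)) * κ)) (Icc a b) t :=
    fun t ht => (hV t ht).mul (by
      have := (((hasDerivAt_id t).sub_const a).const_mul κ).exp.hasDerivWithinAt (s := Icc a b)
      simpa using this)
  have hanti := antitoneOn_of_hasDerivWithinAt_nonpos (convex_Icc a b)
    (fun t ht => (hd t ht).continuousWithinAt)
    (fun t ht => (hd t (interior_subset ht)).mono interior_subset) fun t ht => by
      have h1 := h t (interior_subset ht)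
      have h2 := Real.exp_pos (κ * (t - a))
      nlinarith
  have := hanti (left_mem_Icc.2 hab) (right_mem_Icc.2 hab) hab
  simpa using this

variable {n m k q ps pS pd : ℕ}

namespace Setup

variable {A : Setup n m k q ps pS pd}

/-- Energy decay of the parameter error on an interval where `Δ²` is bounded below. -/
theorem IsTrajectory.dotProduct_mul_exp_le {w : Evolution n q ps pS pd} (hw : A.IsTrajectory w)
    (hγg : 0 < A.γg) (hγ : 0 < A.γ) (hY : ∀ t, 0 ≤ t → A.Y w t = A.Ω w t ⬝ᵥ A.Q.G A.θ)
    {ρ : ℝ} (hρ : 0 < ρ) (hmono : ∀ a b : Vec q, ρ * ((a - b) ⬝ᵥ (a - b)) ≤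
      (a - b) ⬝ᵥ (A.P *ᵥ (A.T *ᵥ A.Q.G a - A.T *ᵥ A.Q.G b)))
    {D s t : ℝ} (hs : 0 ≤ s) (hst : s ≤ t) (hD : ∀ τ ∈ Icc s t, D ^ 2 ≤ Δ w τ ^ 2)
    {z : ℝ → Vec n × Vec q} (hz : IsSolution (A.errorField w) s t z) :
    ((z t).2 ⬝ᵥ (z t).2) * Real.exp (2 * A.γ * ρ * D ^ 2 * (t - s)) ≤ (z s).2 ⬝ᵥ (z s).2 := by
  refine mul_exp_le_of_hasDerivWithinAt (V := fun τ => (z τ).2 ⬝ᵥ (z τ).2) hst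
    (fun τ hτ => hasDerivWithinAt_dotProduct_self (e := fun τ => (z τ).2)
      (hasFDerivAt_snd.comp_hasDerivWithinAt τ (hz τ hτ))) fun τ hτ => ?_
  change 2 * ((z τ).2 ⬝ᵥ A.estimatorField w τ ((z τ).2 + A.θ)) ≤ _
  rw [hw.estimatorField_eq hγg hY (hs.trans hτ.1), dotProduct_smul, smul_eq_mul]
  have h1 := hmono ((z τ).2 + A.θ) A.θ
  rw [add_sub_cancel_right] at h1
  set X := (z τ).2 ⬝ᵥ (A.P *ᵥ (A.T *ᵥ A.Q.G ((z τ).2 + A.θ) - A.T *ᵥ A.Q.G A.θ))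
  have h2 := dotProduct_self_nonneg_real (z τ).2
  have h3 : ρ * ((z τ).2 ⬝ᵥ (z τ).2) * D ^ 2 ≤ X * Δ w τ ^ 2 :=
    mul_le_mul h1 (hD τ hτ) (sq_nonneg _) ((by positivity : 0 ≤ ρ * ((z τ).2 ⬝ᵥ (z τ).2)).trans h1)
  nlinarith

/-- The parameter error does not grow, and decays exponentially after the interval of
excitation. -/
theorem exists_paramError_decay (A : Setup n m k q ps pS pd) (hγg : 0 < A.γg) (hγ : 0 < A.γ)
    (hβ : IsControlLaw A.β) (hE : IsSource A.E)
    (hY : ∀ w, A.IsTrajectory w → ∀ t, 0 ≤ t → A.Y w t = A.Ω w t ⬝ᵥ A.Q.G A.θ)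
    (hmono : StronglyMonotone A.P (fun ϑ => A.T *ᵥ A.Q.G ϑ))
    {M C tc : ℝ} (hC : 0 < C) (htc : 0 < tc) :
    ∃ a : ℝ, 0 < a ∧ ∀ w, A.IsTrajectory w → BoundedExciting M C tc (A.Ω w) →
      ∀ t₀ t : ℝ, 0 ≤ t₀ → t₀ ≤ t → ∀ z, IsSolution (A.errorField w) t₀ t z →
        ‖(z t).2‖ ≤ (q + 1) * ‖(z t₀).2‖ ∧
        ∀ σ, 0 ≤ σ → t₀ + tc + σ ≤ t →
          ‖(z t).2‖ ≤ (q + 1) * ‖(z t₀).2‖ * Real.exp (-(a * σ)) := by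
  obtain ⟨ρ, hρ, hmono⟩ := hmono
  obtain ⟨D, hD, hΔ⟩ := A.exists_le_abs_Δ hγg hβ hE (M := M) hC htc
  refine ⟨A.γ * ρ * D ^ 2, by positivity, fun w hw hex t₀ t h₀ ht z hz => ?_⟩
  -- Taking `D = 0` in the decay estimate gives monotonicity without any excitation.
  have hle : ∀ s ∈ Icc t₀ t, (z s).2 ⬝ᵥ (z s).2 ≤ ((q + 1) * ‖(z t₀).2‖) ^ 2 := fun s hs => by
    have h1 := hw.dotProduct_mul_exp_le hγg hγ (hY w hw) hρ hmono h₀ hs.1 (D := 0)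
      (fun τ _ => by rw [zero_pow two_ne_zero]; positivity) (hz.mono le_rfl hs.2)
    have h2 := h1.trans (dotProduct_self_le (z t₀).2)
    simpa using h2
  refine ⟨abs_le_of_sq_le_sq' ((norm_sq_le_dotProduct_self _).trans (hle t ⟨ht, le_rfl⟩))
    (by positivity) |>.2, fun σ hσ hσt => ?_⟩
  have hs : t₀ ≤ t₀ + tc := by linarith
  -- Since `t₀ ≥ 0`, the lower bound on `Δ` holds from `t₀ + tc` on for every initial time; waiting
  -- `tc` even when `t₀` is late keeps the estimate uniform in `t₀`.
  have h1 := hw.dotProduct_mul_exp_le hγg hγ (hY w hw) hρ hmono (h₀.trans hs)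
    (show t₀ + tc ≤ t by linarith) (D := D)
    (fun τ hτ => by
      rw [← sq_abs (Δ w τ)]
      have := hΔ w hw hex τ (by linarith [hτ.1])
      gcongr) (hz.mono hs le_rfl)
  refine abs_le_of_sq_le_sq' ((norm_sq_le_dotProduct_self _).trans ?_) (by positivity) |>.2
  have h2 := h1.trans (hle (t₀ + tc) ⟨hs, by linarith⟩)
  have h3 : Real.exp (2 * A.γ * ρ * D ^ 2 * σ)
      ≤ Real.exp (2 * A.γ * ρ * D ^ 2 * (t - (t₀ + tc))) :=
    Real.exp_le_exp.2 (mul_le_mul_of_nonneg_left (by linarith) (by positivity))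
  have h4 := (mul_le_mul_of_nonneg_left h3 (dotProduct_self_nonneg_real (z t).2)).trans h2
  have h5 : Real.exp (-(A.γ * ρ * D ^ 2 * σ)) ^ 2 = (Real.exp (2 * A.γ * ρ * D ^ 2 * σ))⁻¹ := by
    rw [← Real.exp_neg, ← Real.exp_nat_mul]
    congr 1
    push_cast
    ring
  rw [mul_pow, h5, ← div_eq_mul_inv, le_div_iff₀ (Real.exp_pos _)]
  exact h4

/-! ### Stability of the adaptive error system -/

/-- As long as the parameter error is small, the tracking error approximately solves the nominal
error dynamics. -/
theorem exists_isApproxSolution (hβ : IsControlLaw A.β) (hE : IsSource A.E)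
    (hxs : IsReference A.xs) {μ : ℝ} (hμ : 0 < μ) :
    ∃ ν : ℝ, 0 < ν ∧ ∀ (w : Evolution n q ps pS pd) (t₀ t₁ : ℝ), 0 ≤ t₀ → ∀ z,
      IsSolution (A.errorField w) t₀ t₁ z → (∀ t ∈ Icc t₀ t₁, ‖(z t).2‖ ≤ ν) →
      IsApproxSolution (nominalField A.pl A.θ A.E A.β A.xs) μ t₀ t₁ (fun t => (z t).1) := by
  obtain ⟨K, -, hK⟩ := exists_nominalField_lipschitz hβ hE hxs
  refine ⟨min 1 (μ / (K + 1)), by positivity, fun w t₀ t₁ h₀ z hz hη t ht =>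
    ⟨_, hasFDerivAt_fst.comp_hasDerivWithinAt t (hz t ht), fun hξ => ?_⟩⟩
  refine (hK w t (h₀.trans ht.1) (z t) hξ ((hη t ht).trans (min_le_left _ _))).trans ?_
  calc (K : ℝ) * ‖(z t).2‖ ≤ (K + 1) * (μ / (K + 1)) :=
        mul_le_mul (by linarith) ((hη t ht).trans (min_le_right _ _)) (norm_nonneg _)
          (by positivity)
    _ = μ := by field_simp

theorem errorField_zero (hstab : IsUAS (nominalField A.pl A.θ A.E A.β A.xs)) (hγg : 0 < A.γg)
    {w : Evolution n q ps pS pd} (hw : A.IsTrajectory w)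
    (hY : ∀ t, 0 ≤ t → A.Y w t = A.Ω w t ⬝ᵥ A.Q.G A.θ) {t : ℝ} (ht : 0 ≤ t) :
    A.errorField w t 0 = 0 := by
  have h1 := hstab.1 _ rfl t ht
  refine Prod.ext ?_ ?_
  · simp only [errorField, perturbation, Prod.fst_zero, Prod.snd_zero, h1, zero_add, sub_self,
      Sum.elim_zero_zero, Matrix.mulVec_zero]
  · simp only [errorField, hw.estimatorField_eq hγg hY ht, Prod.snd_zero, zero_add, sub_self,
      Matrix.mulVec_zero, smul_zero]

/-- A small initial parameter error stays small, so total stability of the nominal dynamics gives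
stability. For attraction, total stability holds the tracking error inside the attraction ball until
the parameter error has decayed; total attractivity then takes over. -/
theorem equiUAS_errorField (hγg : 0 < A.γg) (hγ : 0 < A.γ)
    (hβ : IsControlLaw A.β) (hE : IsSource A.E) (hxs : IsReference A.xs)
    (hstab : IsUAS (nominalField A.pl A.θ A.E A.β A.xs))
    (hY : ∀ w, A.IsTrajectory w → ∀ t, 0 ≤ t → A.Y w t = A.Ω w t ⬝ᵥ A.Q.G A.θ)
    (hmono : StronglyMonotone A.P (fun ϑ => A.T *ᵥ A.Q.G ϑ))
    {M C tc : ℝ} (hC : 0 < C) (htc : 0 < tc) :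
    EquiUAS {F | ∃ w, A.IsTrajectory w ∧ BoundedExciting M C tc (A.Ω w) ∧
      F = A.errorField w} := by
  obtain ⟨K, hN, -⟩ := exists_nominalField_lipschitz hβ hE hxs
  have hsolv := locallySolvable_nominalField hβ hE hxs hstab
  obtain ⟨a, ha, hdec⟩ := A.exists_paramError_decay hγg hγ hβ hE hY hmono (M := M) hC htc
  have hq : (0 : ℝ) < q + 1 := by positivity
  have hgrow : ∀ w, A.IsTrajectory w → BoundedExciting M C tc (A.Ω w) → ∀ t₀ t₁ : ℝ, 0 ≤ t₀ →
      ∀ z, IsSolution (A.errorField w) t₀ t₁ z → ∀ ν, ‖z t₀‖ < ν / (q + 1) →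
      ∀ t ∈ Icc t₀ t₁, ‖(z t).2‖ < ν := by
    intro w hw hex t₀ t₁ h₀ z hz ν hν t ht
    refine (hdec w hw hex t₀ t h₀ ht.1 z (hz.mono le_rfl ht.2)).1.trans_lt ?_
    rw [lt_div_iff₀ hq] at hν
    have := norm_snd_le (z t₀)
    nlinarith
  refine ⟨?_, fun ε hε => ?_, ?_⟩
  · rintro F ⟨w, hw, -, rfl⟩ t ht
    exact errorField_zero hstab hγg hw (hY w hw) ht
  · obtain ⟨δ, hδ, μ, hμ, hst⟩ := hstab.totally_stable hN hsolv hε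
    obtain ⟨ν, hν, hap⟩ := exists_isApproxSolution hβ hE hxs hμ
    refine ⟨min δ (min ν ε / (q + 1)), by positivity, ?_⟩
    rintro F ⟨w, hw, hex, rfl⟩ t₀ t₁ h₀ h01 z hz hz0
    have hη := hgrow w hw hex t₀ t₁ h₀ z hz _ (hz0.trans_le (min_le_right _ _))
    refine max_lt ?_ ((hη t₁ ⟨h01, le_rfl⟩).trans_le (min_le_right _ _))
    exact hst t₀ t₁ h₀ h01 _
      (hap w t₀ t₁ h₀ z hz fun t ht => (hη t ht).le.trans (min_le_left _ _))
      ((norm_fst_le _).trans_lt (hz0.trans_le (min_le_left _ _)))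
  · obtain ⟨r, hr, hatt⟩ := hstab.totally_attractive hN hsolv
    obtain ⟨δ, hδ, μ₀, hμ₀, hst⟩ := hstab.totally_stable hN hsolv hr
    obtain ⟨ν₀, hν₀, hap₀⟩ := exists_isApproxSolution hβ hE hxs hμ₀
    -- This radius comes from the `ε`-independent attraction ball `r`, which the tracking error must
    -- not leave during the waiting phase.
    refine ⟨min δ (ν₀ / (q + 1)), by positivity, fun ε hε => ?_⟩
    obtain ⟨μ, hμ, τ, hτ, hatt⟩ := hatt ε hε
    obtain ⟨ν, hν, hap⟩ := exists_isApproxSolution hβ hE hxs hμ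
    obtain ⟨σ, hσ, hσν⟩ : ∃ σ : ℝ, 0 ≤ σ ∧ ν₀ * Real.exp (-(a * σ)) < min ν ε := by
      have h1 : Tendsto (fun σ : ℝ => ν₀ * Real.exp (-(a * σ))) atTop (𝓝 (ν₀ * 0)) :=
        (Real.tendsto_exp_neg_atTop_nhds_zero.comp (tendsto_id.const_mul_atTop ha)).const_mul _
      rw [mul_zero] at h1
      exact ((eventually_ge_atTop 0).and
        (h1.eventually_lt_const (by positivity : 0 < min ν ε))).exists
    refine ⟨tc + σ + τ, by positivity, ?_⟩
    rintro F ⟨w, hw, hex, rfl⟩ t₀ t₁ h₀ h01 z hz hz0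
    have hη₀ := hgrow w hw hex t₀ t₁ h₀ z hz _ (hz0.trans_le (min_le_right _ _))
    have hη : ∀ t ∈ Icc (t₀ + tc + σ) t₁, ‖(z t).2‖ < min ν ε := by
      intro t ht
      have ht0 : t₀ ≤ t := by linarith [ht.1]
      refine ((hdec w hw hex t₀ t h₀ ht0 z (hz.mono le_rfl ht.2)).2 σ hσ ht.1).trans_lt
        (lt_of_le_of_lt (mul_le_mul_of_nonneg_right ?_ (Real.exp_pos _).le) hσν)
      have h1 := (norm_snd_le (z t₀)).trans (hz0.le.trans (min_le_right _ _))
      rw [le_div_iff₀ hq] at h1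
      linarith
    have hs0 : t₀ ≤ t₀ + tc + σ := by linarith
    have hs1 : t₀ + tc + σ ≤ t₁ := by linarith
    refine max_lt ?_ ((hη t₁ ⟨hs1, le_rfl⟩).trans_le (min_le_right _ _))
    -- The attraction phase starts at `t₀ + tc + σ`, when the defect has fallen below `μ`; that the
    -- tracking error is still below `r` comes from the first phase.
    refine hatt (t₀ + tc + σ) t₁ (h₀.trans hs0) (by linarith) (fun t => (z t).1)
      (hap w _ t₁ (h₀.trans hs0) z (hz.mono hs0 le_rfl)
        fun t ht => (hη t ht).le.trans (min_le_left _ _)) ?_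
    exact hst t₀ _ h₀ hs0 (fun t => (z t).1) ((hap₀ w t₀ t₁ h₀ z hz fun t ht =>
      (hη₀ t ht).le).mono le_rfl le_rfl hs1)
      ((norm_fst_le _).trans_lt (hz0.trans_le (min_le_left _ _)))

/-! ### Convergence and boundedness along closed-loop trajectories -/

theorem IsTrajectory.isSolution_error {w : Evolution n q ps pS pd} (hw : A.IsTrajectory w)
    (hxs : IsReference A.xs) {t₀ t₁ : ℝ} (h₀ : 0 ≤ t₀) :
    IsSolution (A.errorField w) t₀ t₁ (fun t => (A.xErr w t, A.θErr w t)) := by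
  intro t ht
  have ht0 : 0 ≤ t := h₀.trans ht.1
  have hsub : Icc t₀ t₁ ⊆ Ici 0 := fun s hs => h₀.trans hs.1
  refine (HasDerivWithinAt.prodMk (((hw.2 t ht0).1.sub (hxs.1 t ht0).hasDerivWithinAt).mono hsub)
    (((hw.2 t ht0).2.2.2.sub_const A.θ).mono hsub)).congr_deriv ?_
  refine Prod.ext ?_ ?_
  · rw [errorField_fst]
    simp only [xErr, θErr, sub_add_cancel]
    rfl
  · simp only [errorField, θErr, sub_add_cancel]

theorem eventually_forall_le {φ : ℝ → ℝ} {B : ℝ} (h : ∀ t, 0 ≤ t → φ t ≤ B) :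
    ∀ᶠ B in atTop, ∀ t, 0 ≤ t → φ t ≤ B :=
  (eventually_ge_atTop B).mono fun _ hB t ht => (h t ht).trans hB

/-- Bounded errors control the plant signals through the reference and the control law. The
estimator signals are bounded by the gradient-flow energy and the two regression identities. -/
theorem IsTrajectory.allSignalsBounded {w : Evolution n q ps pS pd} (hw : A.IsTrajectory w)
    (hγg : 0 < A.γg) (hβ : IsControlLaw A.β) (hE : IsSource A.E) (hxs : IsReference A.xs)
    (hY : ∀ t, 0 ≤ t → A.Y w t = A.Ω w t ⬝ᵥ A.Q.G A.θ) {M : ℝ}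
    (hM : ∀ t, 0 ≤ t → ‖A.Ω w t‖ ≤ M)
    (herr : ∀ t, 0 ≤ t → ‖(A.xErr w t, A.θErr w t)‖ ≤ 1) : A.AllSignalsBounded w := by
  obtain ⟨Bs, hBs⟩ := hxs.2
  obtain ⟨BE, hBE⟩ := hE.2
  have hxe : ∀ t, 0 ≤ t → ‖A.xErr w t‖ ≤ 1 := fun t ht => (norm_fst_le _).trans (herr t ht)
  have hθe : ∀ t, 0 ≤ t → ‖A.θErr w t‖ ≤ 1 := fun t ht => (norm_snd_le _).trans (herr t ht)
  have hx : ∀ t, 0 ≤ t → ‖w.x t‖ ≤ 1 + max Bs ‖A.θ‖ := fun t ht => by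
    have h := norm_add_le (A.xErr w t) (A.xs t)
    rw [xErr, sub_add_cancel] at h
    exact h.trans (add_le_add (hxe t ht) ((hBs t ht).1.trans (le_max_left _ _)))
  have hθ : ∀ t, 0 ≤ t → ‖w.θh t‖ ≤ 1 + max Bs ‖A.θ‖ := fun t ht => by
    have h := norm_add_le (A.θErr w t) A.θ
    rw [θErr, sub_add_cancel] at h
    exact h.trans (add_le_add (hθe t ht) (le_max_right _ _))
  obtain ⟨L, hL0, hL⟩ := hβ.exists_bound (1 + max Bs ‖A.θ‖)
  have hup : ∀ t, 0 ≤ t → ‖A.up w t‖ ≤ max L BE := fun t ht =>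
    norm_sumElim_le (hL0.trans (le_max_left _ _))
      ((hL t _ _ _ _ ht (hx t ht) (hx t ht) (hθ t ht) (hθ t ht)).1.trans (le_max_left _ _))
      ((hBE t ht).trans (le_max_right _ _))
  obtain ⟨By, hBy⟩ : ∃ B, ∀ t, 0 ≤ t → ‖A.yp w t‖ ≤ B := by
    have hc : Continuous fun z : Vec n × PVec m k => A.pl.h z.1 A.θ + A.pl.j z.1 A.θ *ᵥ z.2 := by
      have hp : Continuous fun z : Vec n × PVec m k => (z.1, A.θ) := by fun_prop
      rw [← continuousOn_univ]
      exact (A.pl.smooth_h.continuous.comp hp).continuousOn.add (continuousOn_mulVec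
        (fun a b => ((A.pl.smooth_j a b).continuous.comp hp).continuousOn) (by fun_prop))
    obtain ⟨B, hB⟩ := (isCompact_closedBall (0 : Vec n × PVec m k)
      (max (1 + max Bs ‖A.θ‖) (max L BE))).exists_bound_of_continuousOn hc.continuousOn
    refine ⟨B, fun t ht => hB (w.x t, A.up w t) ?_⟩
    rw [mem_closedBall_zero_iff]
    exact max_le_max (hx t ht) (hup t ht)
  have htr := hw.isTransition
  have hΦ : ∀ t, 0 ≤ t → ∀ a b, |w.Φ t a b| ≤ 1 := fun t ht => htr.abs_le_one hγg.le ht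
  obtain ⟨BΔ, hBΔ⟩ : ∃ B, ∀ t, 0 ≤ t → |Δ w t| ≤ B := by
    refine ⟨_, fun t ht => Matrix.det_le (abv := AbsoluteValue.abs) (x := 2) fun a b => ?_⟩
    have h1 : |(1 : Matrix (Reg ps pS pd) (Reg ps pS pd) ℝ) a b| ≤ 1 := by
      rw [Matrix.one_apply]
      split_ifs <;> simp
    exact (abs_sub _ _).trans (by linarith [hΦ t ht a b])
  obtain ⟨Bg, hBg⟩ : ∃ B, ∀ t, 0 ≤ t → ‖w.θg t‖ ≤ B := by
    set e₀ := (w.θg 0 - A.Q.G A.θ) ⬝ᵥ (w.θg 0 - A.Q.G A.θ)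
    refine ⟨√e₀ + ‖A.Q.G A.θ‖, fun t ht => ?_⟩
    have h1 := (hw.isGradientFlow hY).antitoneOn hγg.le (mem_Ici.2 le_rfl) (mem_Ici.2 ht) ht
    have h2 := Real.le_sqrt_of_sq_le ((norm_sq_le_dotProduct_self _).trans h1)
    have h3 := norm_add_le (w.θg t - A.Q.G A.θ) (A.Q.G A.θ)
    rw [sub_add_cancel] at h3
    linarith
  have hcalY : ∀ t, 0 ≤ t → ‖calY w t‖ ≤ BΔ * ‖A.Q.G A.θ‖ := fun t ht => by
    rw [hw.calY_eq hγg hY ht, norm_smul]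
    exact mul_le_mul_of_nonneg_right (hBΔ t ht) (norm_nonneg _)
  have hYb : ∀ t, 0 ≤ t → |A.Y w t| ≤ Fintype.card (Reg ps pS pd) * (M * ‖A.Q.G A.θ‖) :=
    fun t ht => by
      rw [hY t ht]
      exact abs_dotProduct_le (fun i => (norm_le_pi_norm _ i).trans (hM t ht))
        (fun i => norm_le_pi_norm (A.Q.G A.θ) i) ((norm_nonneg _).trans (hM t ht))
  -- Each bound holds for all large `B`, so intersecting the eventual statements yields a common
  -- one.
  have hev := (eventually_forall_le hx).and <| (eventually_forall_le hup).and <|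
    (eventually_forall_le hBy).and <| (eventually_forall_le hθ).and <|
    (eventually_forall_le hBg).and <| (eventually_forall_le hBΔ).and <|
    (eventually_forall_le hcalY).and <| (eventually_forall_le hM).and <|
    (eventually_forall_le hYb).and (eventually_ge_atTop 1)
  obtain ⟨B, h1, h2, h3, h4, h5, h6, h7, h8, h9, h10⟩ := hev.exists
  exact ⟨B, fun t ht => ⟨h1 t ht, (hxe t ht).trans h10, h2 t ht, h3 t ht, h4 t ht,
    (hθe t ht).trans h10, h5 t ht, fun a b => (hΦ t ht a b).trans h10, h6 t ht, h7 t ht, h8 t ht,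
    h9 t ht⟩⟩

theorem exists_radius_convergence (hγg : 0 < A.γg)
    (hβ : IsControlLaw A.β) (hE : IsSource A.E) (hxs : IsReference A.xs)
    (hY : ∀ w, A.IsTrajectory w → ∀ t, 0 ≤ t → A.Y w t = A.Ω w t ⬝ᵥ A.Q.G A.θ) {M C tc : ℝ}
    (h : EquiUAS {F | ∃ w, A.IsTrajectory w ∧ BoundedExciting M C tc (A.Ω w) ∧
      F = A.errorField w}) :
    ∃ r : ℝ, 0 < r ∧ ∀ w, A.IsTrajectory w → BoundedExciting M C tc (A.Ω w) →
      ‖A.xErr w 0‖ < r → ‖A.θErr w 0‖ < r →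
      Tendsto (A.xErr w) atTop (𝓝 0) ∧ A.AllSignalsBounded w := by
  obtain ⟨-, hst, r, hr, hatt⟩ := h
  obtain ⟨δ, hδ, hst⟩ := hst 1 one_pos
  refine ⟨min δ r, by positivity, fun w hw hex hx0 hθ0 => ?_⟩
  have hz0 : ‖(A.xErr w 0, A.θErr w 0)‖ < min δ r := max_lt hx0 hθ0
  refine ⟨Metric.tendsto_atTop.2 fun ε hε => ?_, ?_⟩
  · obtain ⟨τ, hτ, hatt⟩ := hatt ε hε
    refine ⟨τ, fun t ht => ?_⟩
    rw [dist_zero_right]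
    exact (norm_fst_le (A.xErr w t, A.θErr w t)).trans_lt
      (hatt _ ⟨w, hw, hex, rfl⟩ 0 t le_rfl (by linarith) _ (hw.isSolution_error hxs le_rfl)
        (hz0.trans_le (min_le_right _ _)))
  · exact hw.allSignalsBounded hγg hβ hE hxs (hY w hw) hex.1 fun t ht =>
      (hst _ ⟨w, hw, hex, rfl⟩ 0 t le_rfl ht _ (hw.isSolution_error hxs le_rfl)
        (hz0.trans_le (min_le_left _ _))).le

end Setup

end PowerBalanceControl

theorem proposition3 {n m k q ps pS pd : ℕ}
    (A : PowerBalanceControl.Setup n m k q ps pS pd)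
    (s : PowerBalanceControl.PVec m k → PowerBalanceControl.PVec m k →
      PowerBalanceControl.Vec q → ℝ)
    (S d : PowerBalanceControl.Vec n → PowerBalanceControl.Vec q → ℝ)
    -- filter constant and estimator gains
    (hlam : 0 < A.lam) (hγg : 0 < A.γg) (hγ : 0 < A.γ)
    -- dissipativity
    (hdiss : PowerBalanceControl.Dissipative A.pl A.θ s S d)
    -- separable nonlinear parameterization, with `p ≥ q`
    (hrep : PowerBalanceControl.Represents A.Q s S d)
    (hp : q ≤ ps + pS + pd)
    -- strong `P`-monotonicity of `T 𝒢`
    (hP : A.P.PosDef)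
    (hmono : PowerBalanceControl.StronglyMonotone A.P (fun ϑ => A.T *ᵥ A.Q.G ϑ))
    -- reference, external sources, and stabilizing controller for the known parameter
    (hxs : PowerBalanceControl.IsReference A.xs)
    (hE : PowerBalanceControl.IsSource A.E)
    (hβ : PowerBalanceControl.IsControlLaw A.β)
    (hstab : PowerBalanceControl.IsUAS
      (PowerBalanceControl.nominalField A.pl A.θ A.E A.β A.xs))
    -- bound, level and length of the interval of excitation
    (M C tc : ℝ) (hC : 0 < C) (htc : 0 < tc) :
    -- the zero equilibrium of the adaptive error system is uniformly asymptotically stable, with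
    -- moduli common to all trajectories whose regressor is bounded by `M` and interval exciting
    PowerBalanceControl.EquiUAS
      {F | ∃ w, A.IsTrajectory w ∧ PowerBalanceControl.BoundedExciting M C tc (A.Ω w) ∧
        F = A.errorField w} ∧
    -- consequently, trajectories with small initial errors converge with all signals bounded
    ∃ r : ℝ, 0 < r ∧ ∀ w, A.IsTrajectory w →
      PowerBalanceControl.BoundedExciting M C tc (A.Ω w) →
      ‖A.xErr w 0‖ < r → ‖A.θErr w 0‖ < r →
      Filter.Tendsto (A.xErr w) Filter.atTop (nhds 0) ∧ A.AllSignalsBounded w := by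
  have hY : ∀ w, A.IsTrajectory w → ∀ t, 0 ≤ t → A.Y w t = A.Ω w t ⬝ᵥ A.Q.G A.θ :=
    fun w hw t ht => hw.regression hβ hE hdiss hrep ht
  have h := PowerBalanceControl.Setup.equiUAS_errorField hγg hγ hβ hE hxs hstab hY hmono
    (M := M) hC htc
  exact ⟨h, PowerBalanceControl.Setup.exists_radius_convergence hγg hβ hE hxs hY h⟩
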